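/- Let $N=N_f\ge 1$ and $k\ge 0$ be integers, $d=2N$. Let $x^i=(x^1,\dots,x^N,y^1,\dots,y^N)$ be coordinates of Euclidean $\mathbb{R}^{d}$, $z^a=x^a+\mathrm{i}y^a$, and let $\gamma_i$ be the complex gamma matrices, $\{\gamma_i,\gamma_j\}=2\delta_{ij}$, in the oscillator basis $|s_1\ldots s_N\rangle$, $s_a=\pm$, with $\gamma_{\bar z^a}|{+}\rangle=0=\gamma_{z^a}|{-}\rangle$; $|+^N\rangle$ has chirality $+1$. Let $\eta_1\cdot\eta_2=\eta_1^tB\eta_2$ be the invariant bilinear product of spinors, $B=\sigma_1\otimes\sigma_2\otimes\sigma_1\otimes\cdots$, and $\eta^{\rm c}=\eta^tB$. For spinors $I,\tilde I$ let $\Phi=I\otimes\tilde I^{\rm c}$, regarded as a polyform by the inverse of the Clifford map $\mathrm{d}x^{i_1}\wedge\cdots\wedge\mathrm{d}x^{i_q}\mapsto\gamma^{i_1\ldots i_q}$, let $\Phi_q$ be its $q$-form part, and let the type $t(I,\tilde I)$ be the lowest degree of a nonzero $\Phi_q$. For an antisymmetric matrix $M$ write $M=\tfrac12M_{ij}\mathrm{d}x^i\wedge\mathrm{d}x^j$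 also for its two-form, and $\wedge^qM$ for the $q$-th exterior power of this two-form. Fix nonzero complex numbers $a,b,\tilde b,c_0,c_1,c_2,\dots$ (the numerical coefficients of the relations). A point is a tuple $(M,S,I,\tilde I)$ consisting of an antisymmetric complex $2N\times2N$ matrix $M$, a number $S\in\mathbb{C}$, a spinor $I$ of chirality $+1$ and a spinor $\tilde I$ of chirality $(-1)^N$, such that $$M^2=a\,S^2\,1,\qquad M_{ij}\gamma^jI=b\,S\gamma_iI,\qquad M_{ij}\gamma^j\tilde I=\tilde b\,S\gamma_i\tilde I,\qquad \Phi_{2q}=c_q\,S^{k+1-q}\wedge^qM\quad(0\le q\le k+1),$$ $$I\cdot\gamma_{i_1\ldots i_q}I=\tilde I\cdot\gamma_{i_1\ldots i_q}\tilde I=0\quad\text{for all } q\ne N .$$ For $N$ even, let $[2^N]_+$ and $[2^N]_-$ be the orbits under $SO(2N,\mathbb{C})$ (acting by $M\mapsto gMg^t$) of $\mathrm{d}z^1\wedge\mathrm{d}z^2+\cdots+\mathrm{d}z^{N-1}\wedge\mathrm{d}z^N$ and of $\mathrm{d}z^1\wedge\mathrm{d}z^2+\cdots+\mathrm{d}z^{N-1}\wedge\mathrm{d}\bar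 z^N$ respectively. **A.** Every point with $S=0$ satisfies the following. 1. $M^2=0$, and $\wedge^qM=0$ for all $q>N/2$. 2. If $I\ne0$ and $\tilde I\neq0$, then $\mathrm{rank}\,M\le2(k+1)$ and $$\max(\mathrm{rank}\,M,\,2(k+1))\le t(I,\tilde I)\le N .$$ - If moreover $\mathrm{rank}\,M=2(k+1)$, then $\wedge^{k+1}M\ne0$, $t(I,\tilde I)=2(k+1)$, and $\Phi=c_{k+1}\wedge^{k+1}M\wedge\mathrm{e}^{\beta_2}$ for some two-form $\beta_2$. - If moreover $\mathrm{rank}\,M\le2k$, then $\wedge^{k+1}M=0$, $t(I,\tilde I)\ge2(k+2)$, and hence $N\ge2k+4$. 3. If $I=0$ or $\tilde I=0$, then $\wedge^{k+1}M=0$ and $\mathrm{rank}\,M\le2k$. 4. If $N$ is even and $M\in[2^N]_-$, then $I=\tilde I=0$. **B.** (Branching.) Let $M$ be an antisymmetric complex $2N\times2N$ matrix with $M^2=0$ and $\mathrm{rank}\,M\le2k$. Then $(M,0,0,0)$ is a point. If $\mathrm{rank}\,M<N$, or if $N$ is even and $M\in[2^N]_+$, then there are a spinor $I\ne0$ such that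 $(M,0,I,0)$ is a point and a spinor $\tilde I\ne0$ such that $(M,0,0,\tilde I)$ is a point. If $\mathrm{rank}\,M=N$, then $N$ is even and $M$ lies in exactly one of $[2^N]_+$ and $[2^N]_-$; so the locus $S=0$, $\mathrm{rank}\,M=N$ splits into a branch on which a nonzero spinor is possible and a branch on which $I=\tilde I=0$. -/

import Mathlib

noncomputable section

namespace HiggsBranch

open Matrix

/-! ### Spinors of `Spin(2N, ℂ)` in the oscillator basis -/

/-- Labels of the real coordinates of `2N`-dimensional Euclidean space: `inl a` stands for
`x^a` and `inr a` for `y^a`, where `z^a = x^a + i y^a`. -/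
abbrev Idx (N : ℕ) : Type := Fin N ⊕ Fin N

/-- Labels `|s_1 … s_N⟩` of the oscillator basis; `0` stands for `+` and `1` for `-`. -/
abbrev SpinIdx (N : ℕ) : Type := Fin N → Fin 2

/-- Dirac spinors in dimension `2N`. -/
abbrev Spinor (N : ℕ) : Type := SpinIdx N → ℂ

/-- The first Pauli matrix. -/
def pauli1 : Matrix (Fin 2) (Fin 2) ℂ := !![0, 1; 1, 0]

/-- The second Pauli matrix. -/
def pauli2 : Matrix (Fin 2) (Fin 2) ℂ := !![0, -Complex.I; Complex.I, 0]

/-- The third Pauli matrix. -/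
def pauli3 : Matrix (Fin 2) (Fin 2) ℂ := !![1, 0; 0, -1]

/-- The tensor product `A_1 ⊗ … ⊗ A_N` of `2 × 2` matrices, acting on spinors. -/
def tensor {N : ℕ} (A : Fin N → Matrix (Fin 2) (Fin 2) ℂ) :
    Matrix (SpinIdx N) (SpinIdx N) ℂ :=
  Matrix.of fun s t => ∏ a, A a (s a) (t a)

/-- The gamma matrices `γ_i`, with `γ_i γ_j + γ_j γ_i = 2 δ_{ij}`:
`γ_{x^a} = σ₃ ⊗ … ⊗ σ₃ ⊗ σ₁ ⊗ 1 ⊗ … ⊗ 1` and `γ_{y^a} = σ₃ ⊗ … ⊗ σ₃ ⊗ σ₂ ⊗ 1 ⊗ … ⊗ 1`, with the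
distinguished factor at position `a`. Equivalently, `γ_{z^a} = (γ_{x^a} - i γ_{y^a}) / 2` has
`(σ₁ - i σ₂) / 2` there, so that `γ_{z}|-⟩ = 0 = γ_{z̄}|+⟩`. -/
def gamma {N : ℕ} : Idx N → Matrix (SpinIdx N) (SpinIdx N) ℂ
  | Sum.inl a => tensor fun b => if b < a then pauli3 else if b = a then pauli1 else 1
  | Sum.inr a => tensor fun b => if b < a then pauli3 else if b = a then pauli2 else 1

/-- The chirality matrix `σ₃ ⊗ … ⊗ σ₃`, a multiple of the product of all gamma matrices; the
spinor `|+ … +⟩` has chirality `+1`. -/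
def chirality (N : ℕ) : Matrix (SpinIdx N) (SpinIdx N) ℂ := tensor fun _ => pauli3

/-- The intertwiner `B = σ₁ ⊗ σ₂ ⊗ σ₁ ⊗ …`, which satisfies `γ_iᵗ B = B γ_i`. -/
def conjB (N : ℕ) : Matrix (SpinIdx N) (SpinIdx N) ℂ :=
  tensor fun a => if Even a.val then pauli1 else pauli2

/-- The invariant bilinear inner product `η₁ · η₂ = η₁ᵗ B η₂` of spinors. -/
def spinorInner {N : ℕ} (η₁ η₂ : Spinor N) : ℂ := η₁ ⬝ᵥ (conjB N *ᵥ η₂)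

/-! ### Polyforms -/

/-- Polyforms with constant coefficients on `2N`-dimensional Euclidean space. -/
abbrev Polyform (N : ℕ) : Type := ExteriorAlgebra ℂ (Idx N → ℂ)

/-- The covector `dx^i`. -/
def dx {N : ℕ} (i : Idx N) : Idx N → ℂ := Pi.single i 1

/-- The component of form degree `q` of a polyform. -/
def formPart {N : ℕ} (q : ℕ) (ω : Polyform N) : Polyform N :=
  GradedRing.proj (fun n : ℕ => ⋀[ℂ]^n (Idx N → ℂ)) q ω

/-- `e^β` for a two-form `β`; the exponential series stops at degree `2N`. -/
def expForm {N : ℕ} (β : Polyform N) : Polyform N :=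
  ∑ m ∈ Finset.range (N + 1), ((m.factorial : ℂ)⁻¹) • β ^ m

/-- The two-form `½ M_{ij} dx^i ∧ dx^j` of a matrix `M`. Its powers in the exterior algebra are the
forms `∧^q M`. -/
def twoForm {N : ℕ} (M : Matrix (Idx N) (Idx N) ℂ) : Polyform N :=
  (2⁻¹ : ℂ) • ∑ i, ∑ j, M i j • (ExteriorAlgebra.ι ℂ (dx i) * ExteriorAlgebra.ι ℂ (dx j))

/-- The summand of form degree `q` in the Fierz expansion of `I ⊗ Ĩᶜ`, namely
`(2^N q!)⁻¹ ∑_{i_1, …, i_q} (Ĩ · γ_{i_q} ⋯ γ_{i_1} I) dx^{i_1} ∧ … ∧ dx^{i_q}`.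
The wedge product antisymmetrizes the product of gamma matrices. -/
def fierzTerm {N : ℕ} (q : ℕ) (I It : Spinor N) : Polyform N :=
  ((2 : ℂ) ^ N * (q.factorial : ℂ))⁻¹ •
    ∑ i : Fin q → Idx N,
      spinorInner It ((((List.ofFn i).reverse.map gamma).prod) *ᵥ I) •
        ExteriorAlgebra.ιMulti ℂ q (fun j => dx (i j))

/-- The bispinor `Φ = I ⊗ Ĩᶜ`, as a polyform: its image under the inverse
`γ^{i_1 … i_q} ↦ dx^{i_1} ∧ … ∧ dx^{i_q}` of the Clifford map. -/
def bispinor {N : ℕ} (I It : Spinor N) : Polyform N :=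
  ∑ q ∈ Finset.range (2 * N + 1), fierzTerm q I It

/-- The type `t(I, Ĩ)`: the lowest form degree that appears in `Φ = I ⊗ Ĩᶜ`. It is meaningful for
`Φ ≠ 0`. -/
def spinorType {N : ℕ} (I It : Spinor N) : ℕ :=
  sInf {q | formPart q (bispinor I It) ≠ 0}

/-- The purity relation: `I · γ_{i_1 … i_q} I = 0` for all `q ≠ N`. -/
def PurityRelation {N : ℕ} (I : Spinor N) : Prop :=
  ∀ q : ℕ, q ≠ N → formPart q (bispinor I I) = 0

/-- The relation `M_{ij} γ^j η = a γ_i η` for all `i`. -/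
def MesonSpinorRelation {N : ℕ} (M : Matrix (Idx N) (Idx N) ℂ) (a : ℂ) (η : Spinor N) : Prop :=
  ∀ i, ∑ j, M i j • (gamma j *ᵥ η) = a • (gamma i *ᵥ η)

/-! ### The chiral ring relations -/

/-- The (convention dependent) nonzero numerical coefficients of the chiral ring relations. -/
structure Coefficients where
  /-- coefficient in `M² = meson S² 1` -/
  meson : ℂ
  /-- coefficient in `M_{ij} γ^j I = left S γ_i I` -/
  left : ℂ
  /-- coefficient in `M_{ij} γ^j Ĩ = right S γ_i Ĩ` -/
  right : ℂ
  /-- coefficients in `Φ_{2q} = bilin q S^{k+1-q} ∧^q M` -/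
  bilin : ℕ → ℂ
  meson_ne : meson ≠ 0
  left_ne : left ≠ 0
  right_ne : right ≠ 0
  bilin_ne : ∀ q, bilin q ≠ 0

/-- Values of the generators: the mesons `M`, the gaugino bilinear `S`, the instanton `I` and the
anti-instanton `Ĩ`. -/
structure Point (N : ℕ) where
  M : Matrix (Idx N) (Idx N) ℂ
  S : ℂ
  I : Spinor N
  It : Spinor N

/-- The chiral ring relations of the `Sp(k)` theory with `N` flavours at infinite coupling. -/
structure ChiralRing (N k : ℕ) (c : Coefficients) (p : Point N) : Prop where
  antisymm : p.Mᵀ = -p.M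
  chirality_I : chirality N *ᵥ p.I = p.I
  chirality_It : chirality N *ᵥ p.It = (-1 : ℂ) ^ N • p.It
  meson_sq : p.M * p.M = (c.meson * p.S ^ 2) • (1 : Matrix (Idx N) (Idx N) ℂ)
  meson_I : MesonSpinorRelation p.M (c.left * p.S) p.I
  meson_It : MesonSpinorRelation p.M (c.right * p.S) p.It
  bilinear : ∀ q ≤ k + 1,
    formPart (2 * q) (bispinor p.I p.It) = (c.bilin q * p.S ^ (k + 1 - q)) • twoForm p.M ^ q
  pure_I : PurityRelation p.I
  pure_It : PurityRelation p.It

/-! ### The two very even orbits -/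

/-- The covector `dz^a = dx^a + i dy^a`, or `dz̄^a = dx^a - i dy^a` if `barred` is true. -/
def dz {N : ℕ} (barred : Bool) (a : Fin N) : Idx N → ℂ :=
  dx (Sum.inl a) + (if barred then -Complex.I else Complex.I) • dx (Sum.inr a)

/-- The antisymmetric matrix of the two-form `u ∧ v`. -/
def wedgeMatrix {N : ℕ} (u v : Idx N → ℂ) : Matrix (Idx N) (Idx N) ℂ :=
  vecMulVec u v - vecMulVec v u

/-- For `N` even, the matrix of `dz^1 ∧ dz^2 + … + dz^{N-1} ∧ dz^N`, with `dz^N` replaced by `dz̄^N`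
if `barred` is true. -/
def veryEvenRep (N : ℕ) (barred : Bool) : Matrix (Idx N) (Idx N) ℂ :=
  ∑ m : Fin (N / 2),
    wedgeMatrix (dz false (⟨2 * m.val, by omega⟩ : Fin N))
      (dz (barred && decide (2 * m.val + 2 = N)) (⟨2 * m.val + 1, by omega⟩ : Fin N))

/-- The orbit of `veryEvenRep N barred` under `SO(2N, ℂ)`. -/
def veryEvenOrbit (N : ℕ) (barred : Bool) : Set (Matrix (Idx N) (Idx N) ℂ) :=
  {M | ∃ g : Matrix (Idx N) (Idx N) ℂ, g * gᵀ = 1 ∧ g.det = 1 ∧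
    M = g * veryEvenRep N barred * gᵀ}

/-- The nilpotent orbit `[2^N]_+` of `so(2N)`, for `N` even. -/
def orbitPlus (N : ℕ) : Set (Matrix (Idx N) (Idx N) ℂ) := veryEvenOrbit N false

/-- The nilpotent orbit `[2^N]_-` of `so(2N)`, for `N` even. -/
def orbitMinus (N : ℕ) : Set (Matrix (Idx N) (Idx N) ℂ) := veryEvenOrbit N true

end HiggsBranch

end

noncomputable section

namespace HiggsBranch

open Matrix

variable {N : ℕ}

/-! ### The gamma matrices -/

/-! The Clifford map is a linear isomorphism from polyforms to matrices, and the Fierz expansion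
inverts it degree by degree (`fierzMap_cliffordMap`). So `Φ` may be replaced by the rank-one matrix
`I ⊗ Ĩᵗ B` (`cliffordMap_bispinor`). Left multiplication by `γ_v` is `v∧ + v⌟`, and right
multiplication on even forms is `v∧ - v⌟`. Hence every `v` annihilating both spinors satisfies `v ∧
Φ = 0`, and `Φ` is divisible by the volume form of `K = Ann I ∩ Ann Ĩ`. At `S = 0` the meson-spinor
relations put the image of `M` inside `K`, so the type is at least `rank M`. Chirality acts as a
Hodge star, so the type is at most `N`. The bilinear relations kill `Φ` below degree `2k+2` and
equate its part there with `∧^{k+1} M`, which is nonzero exactly when `rank M ≥ 2k+2`; this gives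
the dichotomy on the rank.

The operator `X ↦ γ_i X γ^i` has eigenvalue `(-1)^q (2N - 2q)` on `q`-forms, so the purity relation
says that it kills `I ⊗ Iᵗ B`. By rank-nullity this means an annihilator of maximal dimension `N`
(for nonzero spinors). Such annihilators equal their own orthogonal complements, so contraction of
`Φ` with a functional vanishing on `K` is again a wedge product with a covector. The degree operator
then acts on `Φ` as `dim K + 2β∧`, and this recursion sums to an exponential.

For the branching, `M² = 0` makes the image of `M` isotropic. Any isotropic subspace annihilates a
nonzero chiral spinor, built by applying `γ_v` repeatedly; below dimension `N` both chiralities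
occur among pure spinors. If `rank M = N`, a basis of the image is the image of `dz^1, …, dz^N`
under an orthogonal `g`. The sign of `det g` selects the orbit and also fixes the chirality of the
annihilated spinors. -/

lemma tensor_mul (A B : Fin N → Matrix (Fin 2) (Fin 2) ℂ) :
    tensor A * tensor B = tensor fun a => A a * B a := by
  ext s t
  simp only [tensor, mul_apply, of_apply, Fintype.piFinset_univ, Finset.prod_univ_sum,
    Finset.prod_mul_distrib]

lemma tensor_transpose (A : Fin N → Matrix (Fin 2) (Fin 2) ℂ) :
    (tensor A)ᵀ = tensor fun a => (A a)ᵀ := by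
  ext s t
  simp [tensor]

lemma tensor_smul (c : Fin N → ℂ) (A : Fin N → Matrix (Fin 2) (Fin 2) ℂ) :
    (tensor fun a => c a • A a) = (∏ a, c a) • tensor A := by
  ext s t
  simp [tensor, Finset.prod_mul_distrib]

lemma tensor_one : (tensor fun _ : Fin N => 1) = 1 := by
  ext s t
  simp only [tensor, of_apply, one_apply]
  by_cases h : s = t
  · simp [h]
  · obtain ⟨a, ha⟩ := Function.ne_iff.mp h
    rw [if_neg h]
    exact Finset.prod_eq_zero (Finset.mem_univ a) (if_neg ha)

/-- Reduces anticommutation of tensor products to a sign at a single site. -/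
lemma tensor_eq_neg (A B : Fin N → Matrix (Fin 2) (Fin 2) ℂ) (a : Fin N) (ha : A a = -B a)
    (h : ∀ b, b ≠ a → A b = B b) : tensor A = -tensor B := by
  have : A = fun b => (if b = a then (-1 : ℂ) else 1) • B b := by
    funext b
    split_ifs with hb
    · subst hb; simp [ha]
    · simp [h b hb]
  rw [this, tensor_smul]
  simp

lemma pauli1_mul_pauli1 : pauli1 * pauli1 = 1 := by
  ext i j; fin_cases i <;> fin_cases j <;> simp [pauli1]

lemma pauli2_mul_pauli2 : pauli2 * pauli2 = 1 := by
  ext i j; fin_cases i <;> fin_cases j <;> simp [pauli2]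

lemma pauli3_mul_pauli3 : pauli3 * pauli3 = 1 := by
  ext i j; fin_cases i <;> fin_cases j <;> simp [pauli3]

lemma pauli2_mul_pauli1 : pauli2 * pauli1 = -(pauli1 * pauli2) := by
  ext i j; fin_cases i <;> fin_cases j <;> simp [pauli1, pauli2]

lemma pauli3_mul_pauli1 : pauli3 * pauli1 = -(pauli1 * pauli3) := by
  ext i j; fin_cases i <;> fin_cases j <;> simp [pauli1, pauli3]

lemma pauli3_mul_pauli2 : pauli3 * pauli2 = -(pauli2 * pauli3) := by
  ext i j; fin_cases i <;> fin_cases j <;> simp [pauli2, pauli3]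

lemma pauli1_mul_pauli2 : pauli1 * pauli2 = Complex.I • pauli3 := by
  ext i j; fin_cases i <;> fin_cases j <;> simp [pauli1, pauli2, pauli3]

lemma pauli1_transpose : pauli1ᵀ = pauli1 := by
  ext i j; fin_cases i <;> fin_cases j <;> simp [pauli1]

lemma pauli2_transpose : pauli2ᵀ = -pauli2 := by
  ext i j; fin_cases i <;> fin_cases j <;> simp [pauli2]

lemma pauli3_transpose : pauli3ᵀ = pauli3 := by
  ext i j; fin_cases i <;> fin_cases j <;> simp [pauli3]

/-- The position of a coordinate in the oscillator basis. -/
def site : Idx N → Fin N := Sum.elim id id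

/-- The distinguished tensor factor of a gamma matrix. -/
def pauliFactor : Idx N → Matrix (Fin 2) (Fin 2) ℂ := Sum.elim (fun _ => pauli1) fun _ => pauli2

lemma gamma_eq (i : Idx N) : gamma i = tensor fun b =>
    if b < site i then pauli3 else if b = site i then pauliFactor i else 1 := by
  rcases i with a | a <;> rfl

lemma pauliFactor_sq (i : Idx N) : pauliFactor i * pauliFactor i = 1 := by
  rcases i with a | a
  exacts [pauli1_mul_pauli1, pauli2_mul_pauli2]

lemma pauli3_mul_pauliFactor (i : Idx N) :
    pauli3 * pauliFactor i = -(pauliFactor i * pauli3) := by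
  rcases i with a | a
  exacts [pauli3_mul_pauli1, pauli3_mul_pauli2]

lemma gamma_mul_self (i : Idx N) : gamma i * gamma i = 1 := by
  rw [gamma_eq, tensor_mul, ← tensor_one]
  congr 1
  funext b
  split_ifs
  exacts [pauli3_mul_pauli3, pauliFactor_sq i, one_mul 1]

lemma gamma_mul_gamma_of_site_lt {i j : Idx N} (h : site i < site j) :
    gamma i * gamma j = -(gamma j * gamma i) := by
  rw [gamma_eq, gamma_eq, tensor_mul, tensor_mul]
  refine tensor_eq_neg _ _ (site i) ?_ fun b hb => ?_
  · simp [h, pauli3_mul_pauliFactor]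
  · rcases lt_or_gt_of_ne hb with h1 | h1
    · simp [h1, h1.trans h]
    · simp [hb, h1.not_gt]

lemma gamma_anticomm {i j : Idx N} (h : i ≠ j) : gamma i * gamma j = -(gamma j * gamma i) := by
  rcases lt_trichotomy (site i) (site j) with h1 | h1 | h1
  · exact gamma_mul_gamma_of_site_lt h1
  · have key (a : Fin N) : gamma (Sum.inr a) * gamma (Sum.inl a)
        = -(gamma (Sum.inl a) * gamma (Sum.inr a)) := by
      rw [gamma_eq, gamma_eq, tensor_mul, tensor_mul]
      refine tensor_eq_neg _ _ a ?_ fun b hb => ?_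
      · simp [site, pauliFactor, pauli2_mul_pauli1]
      · simp [site, hb]
    rcases i with a | a <;> rcases j with b | b <;> simp only [site, Sum.elim_inl, Sum.elim_inr, id]
      at h1 <;> subst h1
    · exact absurd rfl h
    · rw [key, neg_neg]
    · exact key a
    · exact absurd rfl h
  · rw [gamma_mul_gamma_of_site_lt h1, neg_neg]

lemma chirality_mul_self : chirality N * chirality N = 1 := by
  rw [chirality, tensor_mul, ← tensor_one]
  simp only [pauli3_mul_pauli3]

lemma chirality_mul_gamma (i : Idx N) : chirality N * gamma i = -(gamma i * chirality N) := by
  rw [gamma_eq, chirality, tensor_mul, tensor_mul]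
  refine tensor_eq_neg _ _ (site i) ?_ fun b hb => ?_
  · simp [pauli3_mul_pauliFactor]
  · simp only [hb, if_false]
    split_ifs <;> simp

lemma conjB_mul_self : conjB N * conjB N = 1 := by
  rw [conjB, tensor_mul, ← tensor_one]
  congr 1
  funext b
  split_ifs
  exacts [pauli1_mul_pauli1, pauli2_mul_pauli2]

lemma gamma_transpose_mul_conjB (i : Idx N) : (gamma i)ᵀ * conjB N = conjB N * gamma i := by
  -- Moving past `B` costs `-1` for each `σ₃` to the left of the site and `(-1)^site` at the site
  -- itself; the two contributions cancel.
  have hs : ∏ b : Fin N, (if b < site i then (-1 : ℂ) else if b = site i then (-1) ^ b.val else 1)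
      = 1 := by
    rw [Finset.prod_ite, Finset.prod_const, Finset.prod_ite_eq_of_mem']
    · have : (Finset.univ.filter fun b : Fin N => b < site i) = Finset.Iio (site i) := by
        ext; simp
      rw [this, Fin.card_Iio, ← mul_pow]
      simp
    · simp
  rw [gamma_eq, tensor_transpose, conjB, tensor_mul, tensor_mul]
  refine Eq.trans ?_ (one_smul ℂ (tensor _))
  rw [← hs, ← tensor_smul]
  congr 1
  funext b
  have h3 : ∀ i : Idx N, (pauliFactor i)ᵀ * (if Even b.val then pauli1 else pauli2) =
      (-1 : ℂ) ^ b.val • ((if Even b.val then pauli1 else pauli2) * pauliFactor i) := by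
    rintro (a | a) <;> split_ifs with he <;>
      simp [pauliFactor, pauli1_transpose, pauli2_transpose, he, Nat.not_even_iff_odd.mp,
        pauli2_mul_pauli1]
  by_cases h1 : b < site i
  · split_ifs <;> simp [pauli3_transpose, pauli3_mul_pauli1, pauli3_mul_pauli2]
  · by_cases h2 : b = site i
    · simpa only [h1, h2, if_true, if_false, lt_irrefl] using h2 ▸ h3 i
    · simp [h1, h2]

lemma conjB_mul_chirality : conjB N * chirality N = (-1 : ℂ) ^ N • (chirality N * conjB N) := by
  have : (-1 : ℂ) ^ N = ∏ _b : Fin N, (-1 : ℂ) := by simp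
  rw [conjB, chirality, tensor_mul, tensor_mul, this, ← tensor_smul]
  congr 1
  funext b
  split_ifs
  · simp [pauli3_mul_pauli1]
  · simp [pauli3_mul_pauli2]

lemma chirality_transpose : (chirality N)ᵀ = chirality N := by
  rw [chirality, tensor_transpose]
  simp only [pauli3_transpose]

/-! ### Products of gamma matrices -/

/-- Needed for the lemmas on `List.count` of coordinate indices. -/
instance : LawfulBEq (Idx N) where
  eq_of_beq {i j} h := by
    rcases i with a | a <;> rcases j with b | b
    · exact congrArg Sum.inl (eq_of_beq (α := Fin N) h)
    · exact absurd h Bool.false_ne_true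
    · exact absurd h Bool.false_ne_true
    · exact congrArg Sum.inr (eq_of_beq (α := Fin N) h)
  rfl {i} := by
    rcases i with a | a
    · exact beq_self_eq_true (α := Fin N) a
    · exact beq_self_eq_true (α := Fin N) a

/-- The product `γ_{i_1} ⋯ γ_{i_q}` over a list of indices. -/
def gammaProd (l : List (Idx N)) : Matrix (SpinIdx N) (SpinIdx N) ℂ := (l.map gamma).prod

@[simp] lemma gammaProd_nil : gammaProd ([] : List (Idx N)) = 1 := rfl

@[simp] lemma gammaProd_cons (i : Idx N) (l : List (Idx N)) :
    gammaProd (i :: l) = gamma i * gammaProd l := by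
  simp [gammaProd]

lemma gammaProd_append (l l' : List (Idx N)) :
    gammaProd (l ++ l') = gammaProd l * gammaProd l' := by
  simp [gammaProd]

/-- Each factor passed costs a sign, except a factor `γ_m` itself; modulo two, subtracting the count
is adding it. -/
lemma gamma_mul_gammaProd (m : Idx N) (l : List (Idx N)) :
    gamma m * gammaProd l = (-1 : ℂ) ^ (l.length + l.count m) • (gammaProd l * gamma m) := by
  induction l with
  | nil => simp
  | cons i l ih =>
    rw [gammaProd_cons]
    by_cases h : i = m
    · subst h
      rw [mul_assoc, ← mul_smul_comm]
      congr 1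
      rw [ih, List.length_cons, List.count_cons_self, pow_add, pow_add, pow_add]
      simp [pow_add]
    · rw [← mul_assoc, gamma_anticomm (Ne.symm h), neg_mul, mul_assoc, ih, List.length_cons,
        List.count_cons_of_ne h, mul_smul_comm, mul_assoc, ← neg_smul]
      congr 1
      ring

lemma chirality_mul_gammaProd (l : List (Idx N)) :
    chirality N * gammaProd l = (-1 : ℂ) ^ l.length • (gammaProd l * chirality N) := by
  induction l with
  | nil => simp
  | cons i l ih =>
    rw [gammaProd_cons, ← mul_assoc, chirality_mul_gamma, neg_mul, mul_assoc, ih,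
      List.length_cons, mul_smul_comm, mul_assoc, ← neg_smul]
    congr 1
    ring

lemma trace_eq_zero_of_anticomm {X : Matrix (SpinIdx N) (SpinIdx N) ℂ} {m : Idx N}
    (h : gamma m * X = -(X * gamma m)) : X.trace = 0 := by
  have h1 : X.trace = -X.trace := by
    calc X.trace = (gamma m * (gamma m * X)).trace := by
          rw [← mul_assoc, gamma_mul_self, one_mul]
      _ = -X.trace := by
          rw [h, mul_neg, trace_neg, trace_mul_comm, mul_assoc, gamma_mul_self, mul_one]
  exact self_eq_neg.mp h1

lemma gammaProd_reverse_mul_self (l : List (Idx N)) :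
    gammaProd l.reverse * gammaProd l = 1 := by
  induction l with
  | nil => simp
  | cons i l ih =>
    rw [List.reverse_cons, gammaProd_append, gammaProd_cons, gammaProd_cons, gammaProd_nil, mul_one,
      mul_assoc, ← mul_assoc (gamma i), gamma_mul_self, one_mul, ih]

lemma trace_gammaProd_reverse_mul {l l' : List (Idx N)} (hl : l.Nodup) (hl' : l'.Nodup)
    (h : l.toFinset ≠ l'.toFinset) : (gammaProd l.reverse * gammaProd l').trace = 0 := by
  have hc : ∀ {l : List (Idx N)}, l.Nodup → ∀ m, l.count m = if m ∈ l.toFinset then 1 else 0 := by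
    intro l hl m
    simpa using List.Nodup.count hl
  -- A `γ_m` anticommuting with the product is sought. For even total length any `m` in exactly one
  -- list works. For odd total length any `m` in both or neither works, and one exists: otherwise
  -- the lists would be complementary, with even total length `2N`.
  have key : ∃ m, Odd (l.length + l'.length + (l.count m + l'.count m)) := by
    rcases Nat.even_or_odd (l.length + l'.length) with he | ho
    · obtain ⟨m, hm⟩ : ∃ m, ¬(m ∈ l.toFinset ↔ m ∈ l'.toFinset) := by
        by_contra! hcon
        exact h (Finset.ext hcon)
      refine ⟨m, he.add_odd ?_⟩
      rw [hc hl, hc hl']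
      by_cases h1 : m ∈ l.toFinset <;> by_cases h2 : m ∈ l'.toFinset <;> simp_all
    · obtain ⟨m, hm⟩ : ∃ m, (m ∈ l.toFinset ↔ m ∈ l'.toFinset) := by
        by_contra! hcon
        have hcompl : l'.toFinset = l.toFinsetᶜ := by
          ext m
          have := hcon m
          rw [Finset.mem_compl]
          tauto
        have h2 := Finset.card_add_card_compl l.toFinset
        rw [← hcompl, List.toFinset_card_of_nodup hl, List.toFinset_card_of_nodup hl'] at h2
        rw [h2] at ho
        simp [← two_mul, ← Nat.not_even_iff_odd] at ho
      refine ⟨m, ho.add_even ?_⟩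
      rw [hc hl, hc hl']
      by_cases h1 : m ∈ l.toFinset <;> simp [h1, ← hm]
  obtain ⟨m, hm⟩ := key
  rw [← gammaProd_append]
  refine trace_eq_zero_of_anticomm (m := m) ?_
  rw [gamma_mul_gammaProd, List.length_append, List.count_append, List.length_reverse,
    List.count_reverse, hm.neg_one_pow, neg_one_smul]

/-! ### The Clifford map -/

open CliffordAlgebra (contractLeft)

/-- The matrix `v_i γ^i` of a covector `v`. -/
def gammaLin : (Idx N → ℂ) →ₗ[ℂ] Matrix (SpinIdx N) (SpinIdx N) ℂ :=
  Fintype.linearCombination ℂ gamma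

lemma gammaLin_apply (v : Idx N → ℂ) : gammaLin v = ∑ i, v i • gamma i := rfl

@[simp] lemma gammaLin_dx (i : Idx N) : gammaLin (dx i) = gamma i := by
  simp [gammaLin_apply, dx, Pi.single_apply]

lemma eq_sum_dx (v : Idx N → ℂ) : v = ∑ i, v i • dx i := by
  conv_lhs => rw [← Finset.univ_sum_single v]
  refine Finset.sum_congr rfl fun i _ => ?_
  ext j
  simp [dx, Pi.single_apply]

/-- The Euclidean bilinear form on covectors. -/
def dotForm (N : ℕ) : LinearMap.BilinForm ℂ (Idx N → ℂ) := dotProductBilin ℂ ℂ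

@[simp] lemma dotForm_apply (v w : Idx N → ℂ) : dotForm N v w = v ⬝ᵥ w := rfl

lemma dx_dotProduct (i : Idx N) (v : Idx N → ℂ) : dx i ⬝ᵥ v = v i := by
  simp [dx]

lemma dx_dotProduct_dx (i j : Idx N) : dx i ⬝ᵥ dx j = if i = j then 1 else 0 := by
  rw [dx_dotProduct, dx, Pi.single_apply]

lemma gamma_mul_add (i j : Idx N) :
    gamma i * gamma j + gamma j * gamma i = (2 * (dx i ⬝ᵥ dx j)) • 1 := by
  rw [dx_dotProduct_dx]
  split_ifs with h
  · subst h
    rw [gamma_mul_self, mul_one, two_smul]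
  · rw [gamma_anticomm h]
    simp

lemma gammaLin_mul_add (v w : Idx N → ℂ) :
    gammaLin v * gammaLin w + gammaLin w * gammaLin v = (2 * (v ⬝ᵥ w)) • 1 := by
  have h : (LinearMap.mul ℂ (Matrix (SpinIdx N) (SpinIdx N) ℂ)).compl₁₂ gammaLin gammaLin +
      (LinearMap.mul ℂ (Matrix (SpinIdx N) (SpinIdx N) ℂ)).flip.compl₁₂ gammaLin gammaLin =
      (dotForm N).compr₂ ((2 : ℂ) • LinearMap.toSpanSingleton ℂ _ 1) := by
    refine (Pi.basisFun ℂ (Idx N)).ext fun i => (Pi.basisFun ℂ (Idx N)).ext fun j => ?_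
    have := gamma_mul_add i j
    simp only [← gammaLin_dx] at this
    simpa [dx, mul_smul] using this
  have := LinearMap.congr_fun (LinearMap.congr_fun h v) w
  simpa [mul_smul] using this

lemma gammaLin_mul_self (v : Idx N → ℂ) : gammaLin v * gammaLin v = (v ⬝ᵥ v) • 1 := by
  have h := gammaLin_mul_add v v
  rw [← two_smul ℂ, mul_smul] at h
  exact smul_right_injective _ two_ne_zero h

/-- The representation of the Clifford algebra by gamma matrices. -/
def cliffordRep : CliffordAlgebra (dotForm N).toQuadraticMap →ₐ[ℂ]
    Matrix (SpinIdx N) (SpinIdx N) ℂ :=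
  CliffordAlgebra.lift _ ⟨gammaLin, fun v => by
    rw [gammaLin_mul_self, Algebra.algebraMap_eq_smul_one]; rfl⟩

/-- The Clifford map from polyforms to matrices. -/
def cliffordMap : Polyform N →ₗ[ℂ] Matrix (SpinIdx N) (SpinIdx N) ℂ :=
  cliffordRep.toLinearMap ∘ₗ
    CliffordAlgebra.changeForm (Q := 0) (Q' := (dotForm N).toQuadraticMap) (sub_zero _).symm

/-- The contraction of a polyform with a linear functional on covectors. -/
abbrev contract (f : Module.Dual ℂ (Idx N → ℂ)) : Polyform N →ₗ[ℂ] Polyform N :=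
  contractLeft (Q := 0) f

lemma cliffordMap_one : cliffordMap (1 : Polyform N) = 1 := by
  simp [cliffordMap]

lemma cliffordMap_ι_mul (v : Idx N → ℂ) (ω : Polyform N) :
    cliffordMap (ExteriorAlgebra.ι ℂ v * ω) =
      gammaLin v * cliffordMap ω - cliffordMap (contract (dotForm N v) ω) := by
  have h := CliffordAlgebra.changeForm_ι_mul (Q := 0) (Q' := (dotForm N).toQuadraticMap)
    (sub_zero _).symm v ω
  simp only [cliffordMap, LinearMap.comp_apply]
  -- Contraction commutes with the change of quadratic form, so it can be moved to the exterior
  -- side.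
  rw [CliffordAlgebra.changeForm_contractLeft]
  refine (congrArg _ h).trans ?_
  have hv : cliffordRep (CliffordAlgebra.ι (dotForm N).toQuadraticMap v) = gammaLin v :=
    CliffordAlgebra.lift_ι_apply _ _ _
  rw [AlgHom.toLinearMap_apply, map_sub, map_mul, hv]
  rfl

lemma gammaLin_mul_cliffordMap (v : Idx N → ℂ) (ω : Polyform N) :
    gammaLin v * cliffordMap ω =
      cliffordMap (ExteriorAlgebra.ι ℂ v * ω + contract (dotForm N v) ω) := by
  rw [map_add, cliffordMap_ι_mul, sub_add_cancel]

lemma contract_ι_mul (f : Module.Dual ℂ (Idx N → ℂ)) (v : Idx N → ℂ) (ω : Polyform N) :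
    contract f (ExteriorAlgebra.ι ℂ v * ω) =
      f v • ω - ExteriorAlgebra.ι ℂ v * contract f ω :=
  CliffordAlgebra.contractLeft_ι_mul (Q := 0) f v ω

lemma contract_one (f : Module.Dual ℂ (Idx N → ℂ)) : contract f (1 : Polyform N) = 0 :=
  CliffordAlgebra.contractLeft_one (Q := 0) f

lemma contract_prod_eq_zero (f : Module.Dual ℂ (Idx N → ℂ)) (l : List (Idx N → ℂ))
    (h : ∀ v ∈ l, f v = 0) : contract f (l.map (ExteriorAlgebra.ι ℂ)).prod = 0 := by
  induction l with
  | nil => exact contract_one f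
  | cons v l ih =>
    rw [List.map_cons, List.prod_cons, contract_ι_mul, h v (by simp),
      ih fun w hw => h w (by simp [hw]), zero_smul, mul_zero, sub_zero]

/-- Between orthogonal covectors the contraction terms vanish, so no antisymmetrization is needed.
-/
lemma cliffordMap_prod (l : List (Idx N → ℂ)) (h : l.Pairwise fun v w => v ⬝ᵥ w = 0) :
    cliffordMap (l.map (ExteriorAlgebra.ι ℂ)).prod = (l.map gammaLin).prod := by
  induction l with
  | nil => exact cliffordMap_one
  | cons v l ih =>
    rw [List.pairwise_cons] at h
    rw [List.map_cons, List.prod_cons, cliffordMap_ι_mul, contract_prod_eq_zero _ _ h.1, map_zero,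
      sub_zero, ih h.2, List.map_cons, List.prod_cons]

lemma cliffordMap_prod_dx {l : List (Idx N)} (h : l.Nodup) :
    cliffordMap (l.map fun i => ExteriorAlgebra.ι ℂ (dx i)).prod = gammaProd l := by
  have := cliffordMap_prod (l.map dx) (List.pairwise_map.mpr (h.imp fun {a b} hab => by
    rw [dx_dotProduct_dx, if_neg hab]))
  simpa [Function.comp_def, gammaProd] using this

lemma ιMulti_dx {q : ℕ} (i : Fin q → Idx N) :
    ExteriorAlgebra.ιMulti ℂ q (fun j => dx (i j)) =
      ((List.ofFn i).map fun i => ExteriorAlgebra.ι ℂ (dx i)).prod := by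
  rw [ExteriorAlgebra.ιMulti_apply, List.map_ofFn]; rfl

lemma ιMulti_dx_of_not_injective {q : ℕ} {i : Fin q → Idx N} (h : ¬ Function.Injective i) :
    ExteriorAlgebra.ιMulti ℂ q (fun j => (dx (i j) : Idx N → ℂ)) = 0 :=
  ExteriorAlgebra.ιMulti_eq_zero_of_not_inj fun h' => h fun a b hab => h' (by simp [hab])

lemma cliffordMap_ιMulti_dx {q : ℕ} {i : Fin q → Idx N} (h : Function.Injective i) :
    cliffordMap (ExteriorAlgebra.ιMulti ℂ q (fun j => dx (i j))) = gammaProd (List.ofFn i) := by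
  rw [ιMulti_dx, cliffordMap_prod_dx (List.nodup_ofFn.mpr h)]

lemma span_range_dx : Submodule.span ℂ (Set.range (dx : Idx N → Idx N → ℂ)) = ⊤ := by
  have := (Pi.basisFun ℂ (Idx N)).span_eq
  convert this using 3
  funext i
  simp [dx]

/-- Linear maps on forms of degree `q` agree if they agree on the wedge products of distinct
`dx^i`. -/
lemma eqOn_exteriorPower {W : Type*} [AddCommGroup W] [Module ℂ W] {q : ℕ}
    {f g : Polyform N →ₗ[ℂ] W}
    (h : ∀ i : Fin q → Idx N, Function.Injective i →
      f (ExteriorAlgebra.ιMulti ℂ q (fun j => dx (i j))) =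
        g (ExteriorAlgebra.ιMulti ℂ q (fun j => dx (i j))))
    {ω : Polyform N} (hω : ω ∈ ⋀[ℂ]^q (Idx N → ℂ)) : f ω = g ω := by
  rw [← exteriorPower.ιMulti_span_fixedDegree_of_span_eq_top ℂ q _ span_range_dx] at hω
  refine LinearMap.eqOn_span (f := f) (g := g) ?_ hω
  rintro _ ⟨v, hv, rfl⟩
  choose i hi using fun j => hv (Set.mem_range_self j)
  obtain rfl : (fun j => dx (i j)) = v := funext hi
  by_cases hinj : Function.Injective i
  · exact h i hinj
  · rw [ιMulti_dx_of_not_injective hinj, map_zero, map_zero]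

lemma polyform_induction {P : Polyform N → Prop} (h0 : P 0) (hadd : ∀ x y, P x → P y → P (x + y))
    (h : ∀ q, ∀ ω ∈ ⋀[ℂ]^q (Idx N → ℂ), P ω) (ω : Polyform N) : P ω := by
  induction ω using DirectSum.Decomposition.inductionOn fun i => ⋀[ℂ]^i (Idx N → ℂ) with
  | zero => exact h0
  | add _ _ h1 h2 => exact hadd _ _ h1 h2
  | homogeneous m => exact h _ _ m.2

/-! ### The Fierz identity -/

/-- The form of degree `q` in the Fierz expansion of a matrix. -/
def fierzMap (q : ℕ) : Matrix (SpinIdx N) (SpinIdx N) ℂ →ₗ[ℂ] Polyform N :=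
  ((2 : ℂ) ^ N * (q.factorial : ℂ))⁻¹ • ∑ i : Fin q → Idx N,
    (LinearMap.toSpanSingleton ℂ _ (ExteriorAlgebra.ιMulti ℂ q (fun j => dx (i j)))) ∘ₗ
      Matrix.traceLinearMap _ ℂ ℂ ∘ₗ LinearMap.mulLeft ℂ (gammaProd (List.ofFn i).reverse)

lemma fierzMap_apply (q : ℕ) (X : Matrix (SpinIdx N) (SpinIdx N) ℂ) :
    fierzMap q X = ((2 : ℂ) ^ N * (q.factorial : ℂ))⁻¹ • ∑ i : Fin q → Idx N,
      (gammaProd (List.ofFn i).reverse * X).trace •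
        ExteriorAlgebra.ιMulti ℂ q (fun j => dx (i j)) := by
  simp [fierzMap]

lemma fierzTerm_eq (q : ℕ) (I It : Spinor N) :
    fierzTerm q I It = fierzMap q (vecMulVec I (It ᵥ* conjB N)) := by
  rw [fierzMap_apply, fierzTerm]
  congr 1
  refine Finset.sum_congr rfl fun i _ => ?_
  congr 1
  rw [spinorInner, mul_vecMulVec, trace_vecMulVec, dotProduct_mulVec, dotProduct_comm]
  rfl

lemma fierzMap_gammaProd_of_ne {p q : ℕ} {j : Fin p → Idx N} (hj : Function.Injective j)
    (h : q ≠ p) : fierzMap q (gammaProd (List.ofFn j)) = 0 := by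
  rw [fierzMap_apply, Finset.sum_eq_zero, smul_zero]
  intro i _
  by_cases hi : Function.Injective i
  · rw [trace_gammaProd_reverse_mul (List.nodup_ofFn.mpr hi) (List.nodup_ofFn.mpr hj), zero_smul]
    intro heq
    have := congrArg Finset.card heq
    rw [List.toFinset_card_of_nodup (List.nodup_ofFn.mpr hi),
      List.toFinset_card_of_nodup (List.nodup_ofFn.mpr hj)] at this
    simp at this
    exact h this
  · rw [ιMulti_dx_of_not_injective hi, smul_zero]

lemma fierzMap_gammaProd {q : ℕ} {j : Fin q → Idx N} (hj : Function.Injective j) :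
    fierzMap q (gammaProd (List.ofFn j)) = ExteriorAlgebra.ιMulti ℂ q (fun k => dx (j k)) := by
  rw [fierzMap_apply]
  -- Only reorderings of `j` survive. The trace and the wedge product both pick up the sign of the
  -- permutation, so each of the `q!` reorderings contributes the same term, with `2^N` the trace of
  -- the identity.
  have hterm : ∀ i : Fin q → Idx N, (gammaProd (List.ofFn i).reverse *
        gammaProd (List.ofFn j)).trace • ExteriorAlgebra.ιMulti ℂ q (fun k => dx (i k)) =
      if i ∈ Finset.univ.image (fun σ : Equiv.Perm (Fin q) => j ∘ σ) then
        (2 : ℂ) ^ N • ExteriorAlgebra.ιMulti ℂ q (fun k => dx (j k)) else 0 := by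
    intro i
    split_ifs with hi
    · obtain ⟨σ, -, rfl⟩ := Finset.mem_image.mp hi
      have h1 : ExteriorAlgebra.ιMulti ℂ q (fun k => (dx ((j ∘ σ) k) : Idx N → ℂ)) =
          ((Equiv.Perm.sign σ : ℤ) : ℂ) • ExteriorAlgebra.ιMulti ℂ q (fun k => dx (j k)) := by
        have := (ExteriorAlgebra.ιMulti ℂ q).map_perm (fun k => (dx (j k) : Idx N → ℂ)) σ
        rw [Units.smul_def, ← Int.cast_smul_eq_zsmul ℂ] at this
        exact this
      -- The sign rule for gamma products is inherited from the alternating wedge product through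
      -- the Clifford map.
      have h2 : gammaProd (List.ofFn (j ∘ σ)) =
          ((Equiv.Perm.sign σ : ℤ) : ℂ) • gammaProd (List.ofFn j) := by
        rw [← cliffordMap_ιMulti_dx hj, ← map_smul, ← h1, cliffordMap_ιMulti_dx
          (hj.comp σ.injective)]
      have hs : ((Equiv.Perm.sign σ : ℤ) : ℂ) * ((Equiv.Perm.sign σ : ℤ) : ℂ) = 1 := by
        rcases Int.units_eq_one_or (Equiv.Perm.sign σ) with h | h <;> simp [h]
      have h3 : gammaProd (List.ofFn j) =
          ((Equiv.Perm.sign σ : ℤ) : ℂ) • gammaProd (List.ofFn (j ∘ σ)) := by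
        rw [h2, smul_smul, hs, one_smul]
      rw [h1, h3, mul_smul_comm, gammaProd_reverse_mul_self, trace_smul, trace_one, smul_smul,
        smul_eq_mul, mul_right_comm, hs, one_mul]
      simp
    · by_cases hinj : Function.Injective i
      · rw [trace_gammaProd_reverse_mul (List.nodup_ofFn.mpr hinj) (List.nodup_ofFn.mpr hj),
          zero_smul]
        intro heq
        apply hi
        have hmem : ∀ k, ∃ m, j m = i k := by
          intro k
          have : i k ∈ (List.ofFn i).toFinset := by simp
          rw [heq] at this
          simpa using this
        choose σ hσ using hmem
        have hσinj : Function.Injective σ := fun a b hab => hinj (by rw [← hσ, ← hσ, hab])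
        refine Finset.mem_image.mpr ⟨Equiv.ofBijective σ
          (Finite.injective_iff_bijective.mp hσinj), Finset.mem_univ _, funext hσ⟩
      · rw [ιMulti_dx_of_not_injective hinj, smul_zero]
  simp_rw [hterm]
  rw [Finset.sum_ite_mem, Finset.univ_inter, Finset.sum_const, Finset.card_image_of_injective]
  · rw [Finset.card_univ, Fintype.card_perm, Fintype.card_fin, ← Nat.cast_smul_eq_nsmul ℂ,
      smul_smul, smul_smul, mul_assoc, mul_comm (q.factorial : ℂ) (2 ^ N), inv_mul_cancel₀,
      one_smul]
    exact mul_ne_zero (by simp) (by exact_mod_cast q.factorial_ne_zero)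
  · intro σ τ h
    ext k
    exact congrArg Fin.val (hj (congrFun h k))

lemma fierzMap_cliffordMap {p q : ℕ} {ω : Polyform N} (hω : ω ∈ ⋀[ℂ]^p (Idx N → ℂ)) :
    fierzMap q (cliffordMap ω) = if q = p then ω else 0 := by
  refine eqOn_exteriorPower (f := fierzMap q ∘ₗ cliffordMap)
    (g := if q = p then LinearMap.id else 0) (fun i hi => ?_) hω |>.trans (by split_ifs <;> rfl)
  rw [LinearMap.comp_apply, cliffordMap_ιMulti_dx hi]
  split_ifs with h
  · subst h
    exact fierzMap_gammaProd hi
  · exact fierzMap_gammaProd_of_ne hi h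

lemma exteriorPower_eq_zero {q : ℕ} (hq : 2 * N < q) {ω : Polyform N}
    (hω : ω ∈ ⋀[ℂ]^q (Idx N → ℂ)) : ω = 0 := by
  refine eqOn_exteriorPower (f := LinearMap.id) (g := 0) (fun i hi => ?_) hω
  have := Fintype.card_le_of_injective i hi
  simp [← two_mul] at this
  omega

lemma sum_fierzMap_cliffordMap (ω : Polyform N) :
    ∑ q ∈ Finset.range (2 * N + 1), fierzMap q (cliffordMap ω) = ω := by
  induction ω using polyform_induction with
  | h0 => simp
  | hadd x y hx hy => simp only [map_add, Finset.sum_add_distrib, hx, hy]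
  | h p ω hω =>
    simp_rw [fierzMap_cliffordMap hω, Finset.sum_ite_eq', Finset.mem_range]
    split_ifs with hp
    · rfl
    · exact (exteriorPower_eq_zero (by omega) hω).symm

lemma cliffordMap_injective : Function.Injective (cliffordMap (N := N)) := by
  intro x y h
  rw [← sum_fierzMap_cliffordMap x, h, sum_fierzMap_cliffordMap]

instance : FiniteDimensional ℂ (Polyform N) :=
  FiniteDimensional.of_injective cliffordMap cliffordMap_injective

lemma finrank_polyform : Module.finrank ℂ (Polyform N) = 2 ^ (2 * N) := by
  classical
  let _ : LinearOrder (Idx N) := LinearOrder.lift' finSumFinEquiv finSumFinEquiv.injective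
  rw [Module.finrank_eq_card_basis (Pi.basisFun ℂ (Idx N)).ExteriorAlgebra]
  simp [two_mul]

/-- The Fierz expansion already gives injectivity, and both sides have dimension `2^{2N}`. -/
lemma cliffordMap_surjective : Function.Surjective (cliffordMap (N := N)) := by
  rw [← LinearMap.injective_iff_surjective_of_finrank_eq_finrank]
  · exact cliffordMap_injective
  · rw [finrank_polyform, Module.finrank_matrix]
    simp
    ring

lemma cliffordMap_sum_fierzMap (X : Matrix (SpinIdx N) (SpinIdx N) ℂ) :
    cliffordMap (∑ q ∈ Finset.range (2 * N + 1), fierzMap q X) = X := by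
  obtain ⟨ω, rfl⟩ := cliffordMap_surjective X
  rw [sum_fierzMap_cliffordMap]

lemma cliffordMap_bispinor (I It : Spinor N) :
    cliffordMap (bispinor I It) = vecMulVec I (It ᵥ* conjB N) := by
  simp_rw [bispinor, fierzTerm_eq]
  exact cliffordMap_sum_fierzMap _

/-! ### Homogeneous parts of polyforms -/

lemma formPart_eq_proj (q : ℕ) (ω : Polyform N) :
    formPart q ω = GradedAlgebra.proj (fun n : ℕ => ⋀[ℂ]^n (Idx N → ℂ)) q ω := rfl

lemma formPart_zero (q : ℕ) : formPart q (0 : Polyform N) = 0 := by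
  rw [formPart_eq_proj, map_zero]

lemma formPart_add (q : ℕ) (ω η : Polyform N) :
    formPart q (ω + η) = formPart q ω + formPart q η := by
  simp only [formPart_eq_proj, map_add]

lemma formPart_smul (q : ℕ) (a : ℂ) (ω : Polyform N) :
    formPart q (a • ω) = a • formPart q ω := by
  simp only [formPart_eq_proj, map_smul]

lemma formPart_sum {ι : Type*} (s : Finset ι) (q : ℕ) (ω : ι → Polyform N) :
    formPart q (∑ i ∈ s, ω i) = ∑ i ∈ s, formPart q (ω i) := by
  simp only [formPart_eq_proj, map_sum]

lemma formPart_mem (q : ℕ) (ω : Polyform N) : formPart q ω ∈ ⋀[ℂ]^q (Idx N → ℂ) :=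
  SetLike.coe_mem _

lemma formPart_of_mem {p : ℕ} (q : ℕ) {ω : Polyform N} (h : ω ∈ ⋀[ℂ]^p (Idx N → ℂ)) :
    formPart q ω = if q = p then ω else 0 := by
  rw [formPart, GradedRing.proj_apply]
  split_ifs with hq
  · subst hq
    rw [DirectSum.decompose_of_mem_same (fun n : ℕ => ⋀[ℂ]^n (Idx N → ℂ)) h]
  · rw [DirectSum.decompose_of_mem_ne (fun n : ℕ => ⋀[ℂ]^n (Idx N → ℂ)) h (Ne.symm hq)]

lemma formPart_eq_fierzMap (q : ℕ) (ω : Polyform N) :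
    formPart q ω = fierzMap q (cliffordMap ω) := by
  induction ω using polyform_induction with
  | h0 => simp [formPart_zero]
  | hadd x y hx hy => rw [formPart_add, hx, hy, map_add, map_add]
  | h p ω hω => rw [formPart_of_mem q hω, fierzMap_cliffordMap hω]

lemma sum_formPart (ω : Polyform N) : ∑ q ∈ Finset.range (2 * N + 1), formPart q ω = ω := by
  simp_rw [formPart_eq_fierzMap, sum_fierzMap_cliffordMap]

lemma formPart_eq_zero_of_lt {q : ℕ} (hq : 2 * N < q) (ω : Polyform N) : formPart q ω = 0 :=
  exteriorPower_eq_zero hq (formPart_mem q ω)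

lemma polyform_ext {ω η : Polyform N} (h : ∀ q, formPart q ω = formPart q η) : ω = η := by
  rw [← sum_formPart ω, ← sum_formPart η]
  exact Finset.sum_congr rfl fun q _ => h q

lemma ι_mem_exteriorPower_one (v : Idx N → ℂ) :
    ExteriorAlgebra.ι ℂ v ∈ ⋀[ℂ]^1 (Idx N → ℂ) := by
  rw [ExteriorAlgebra.exteriorPower, pow_one]
  exact LinearMap.mem_range_self _ v

lemma mul_mem_exteriorPower {p q : ℕ} {ω η : Polyform N} (hω : ω ∈ ⋀[ℂ]^p (Idx N → ℂ))
    (hη : η ∈ ⋀[ℂ]^q (Idx N → ℂ)) : ω * η ∈ ⋀[ℂ]^(p + q) (Idx N → ℂ) :=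
  SetLike.mul_mem_graded (A := fun n : ℕ => ⋀[ℂ]^n (Idx N → ℂ)) hω hη

lemma formPart_mul_of_le {p q : ℕ} {ω : Polyform N} (hω : ω ∈ ⋀[ℂ]^p (Idx N → ℂ)) (h : p ≤ q)
    (η : Polyform N) : formPart q (ω * η) = ω * formPart (q - p) η :=
  DirectSum.coe_decompose_mul_of_left_mem_of_le (fun n : ℕ => ⋀[ℂ]^n (Idx N → ℂ)) hω h

lemma formPart_mul_of_lt {p q : ℕ} {ω : Polyform N} (hω : ω ∈ ⋀[ℂ]^p (Idx N → ℂ)) (h : q < p)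
    (η : Polyform N) : formPart q (ω * η) = 0 :=
  DirectSum.coe_decompose_mul_of_left_mem_of_not_le (fun n : ℕ => ⋀[ℂ]^n (Idx N → ℂ)) hω h.not_ge

lemma prod_ι_mem_exteriorPower (l : List (Idx N → ℂ)) :
    (l.map (ExteriorAlgebra.ι ℂ)).prod ∈ ⋀[ℂ]^l.length (Idx N → ℂ) := by
  have := ExteriorAlgebra.ιMulti_range ℂ l.length (M := Idx N → ℂ) ⟨l.get, rfl⟩
  rw [ExteriorAlgebra.ιMulti_apply] at this
  have h : l.map (ExteriorAlgebra.ι ℂ) = List.ofFn fun i => ExteriorAlgebra.ι ℂ (l.get i) := by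
    conv_lhs => rw [← List.ofFn_get l, List.map_ofFn]
    rfl
  rw [h]
  exact this

/-! ### The trace over the vector index and right multiplication -/

/-- The map `X ↦ γ_i X γ^i`. -/
def gammaSum : Matrix (SpinIdx N) (SpinIdx N) ℂ →ₗ[ℂ] Matrix (SpinIdx N) (SpinIdx N) ℂ :=
  ∑ i : Idx N, LinearMap.mulLeft ℂ (gamma i) ∘ₗ LinearMap.mulRight ℂ (gamma i)

lemma gammaSum_apply (X : Matrix (SpinIdx N) (SpinIdx N) ℂ) :
    gammaSum X = ∑ i, gamma i * (X * gamma i) := by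
  simp [gammaSum]

lemma gammaSum_chirality_mul (X : Matrix (SpinIdx N) (SpinIdx N) ℂ) :
    gammaSum (chirality N * X) = -(chirality N * gammaSum X) := by
  rw [gammaSum_apply, gammaSum_apply, Finset.mul_sum, ← Finset.sum_neg_distrib]
  refine Finset.sum_congr rfl fun i _ => ?_
  rw [mul_assoc, ← mul_assoc (gamma i), ← mul_assoc (chirality N), chirality_mul_gamma, neg_mul,
    neg_neg]

/-- The eigenvalue of `X ↦ γ_i X γ^i` on forms of degree `q`. -/
def degreeEigenvalue (N q : ℕ) : ℂ := (-1) ^ q * (2 * N - 2 * q)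

/-- Up to the common sign `(-1)^q`, each of the `2N - q` indices outside the list contributes `+1`
and each of the `q` inside contributes `-1`. -/
lemma gammaSum_gammaProd {l : List (Idx N)} (hl : l.Nodup) :
    gammaSum (gammaProd l) = degreeEigenvalue N l.length • gammaProd l := by
  have h : ∀ i, gamma i * (gammaProd l * gamma i) =
      ((-1 : ℂ) ^ l.length * (1 - 2 * if i ∈ l.toFinset then 1 else 0)) • gammaProd l := by
    intro i
    rw [← mul_assoc, gamma_mul_gammaProd, smul_mul_assoc, mul_assoc, gamma_mul_self, mul_one,
      List.Nodup.count hl, pow_add]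
    by_cases hi : i ∈ l
    · simp [hi]; norm_num
    · simp [hi]
  rw [gammaSum_apply, Finset.sum_congr rfl fun i _ => h i, ← Finset.sum_smul, ← Finset.mul_sum,
    Finset.sum_sub_distrib, ← Finset.mul_sum, Finset.sum_ite_mem, Finset.univ_inter]
  simp only [Finset.sum_const, List.toFinset_card_of_nodup hl, degreeEigenvalue, Finset.card_univ,
    Fintype.card_sum, Fintype.card_fin]
  congr 2
  simp
  ring

lemma gammaSum_cliffordMap {q : ℕ} {ω : Polyform N} (hω : ω ∈ ⋀[ℂ]^q (Idx N → ℂ)) :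
    gammaSum (cliffordMap ω) = degreeEigenvalue N q • cliffordMap ω := by
  refine eqOn_exteriorPower (f := gammaSum ∘ₗ cliffordMap)
    (g := degreeEigenvalue N q • cliffordMap) (fun i hi => ?_) hω
  simp only [LinearMap.comp_apply, LinearMap.smul_apply]
  rw [cliffordMap_ιMulti_dx hi, gammaSum_gammaProd (List.nodup_ofFn.mpr hi), List.length_ofFn]

lemma fierzMap_gammaSum (q : ℕ) (X : Matrix (SpinIdx N) (SpinIdx N) ℂ) :
    fierzMap q (gammaSum X) = degreeEigenvalue N q • fierzMap q X := by
  obtain ⟨ω, rfl⟩ := cliffordMap_surjective X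
  induction ω using polyform_induction with
  | h0 => simp
  | hadd x y hx hy => simp only [map_add, smul_add, hx, hy]
  | h p ω hω =>
    rw [gammaSum_cliffordMap hω, map_smul, fierzMap_cliffordMap hω]
    split_ifs with h
    · rw [h]
    · simp

lemma degreeEigenvalue_eq_zero_iff (q : ℕ) : degreeEigenvalue N q = 0 ↔ q = N := by
  rw [degreeEigenvalue, mul_eq_zero]
  simp only [pow_eq_zero_iff', neg_eq_zero, one_ne_zero, false_and, false_or, sub_eq_zero]
  constructor
  · intro h
    have : (N : ℂ) = q := by linear_combination h / 2
    exact_mod_cast this.symm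
  · rintro rfl; rfl

/-- Opposite parities would force `p = q`, a contradiction; equal parities leave only complementary
degrees. -/
lemma degreeEigenvalue_add_eq_zero {p q : ℕ}
    (h : degreeEigenvalue N p + degreeEigenvalue N q = 0) : p + q = 2 * N := by
  rw [degreeEigenvalue, degreeEigenvalue] at h
  rcases Nat.even_or_odd p with hp | hp <;> rcases Nat.even_or_odd q with hq | hq <;>
    simp only [hp.neg_one_pow, hq.neg_one_pow] at h
  · have : ((p + q : ℕ) : ℂ) = (2 * N : ℕ) := by push_cast; linear_combination -h / 2
    exact_mod_cast this
  · have : ((p : ℕ) : ℂ) = (q : ℕ) := by linear_combination -h / 2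
    have : p = q := by exact_mod_cast this
    subst this
    exact absurd hp (Nat.not_even_iff_odd.mpr hq)
  · have : ((p : ℕ) : ℂ) = (q : ℕ) := by linear_combination h / 2
    have : p = q := by exact_mod_cast this
    subst this
    exact absurd hq (Nat.not_even_iff_odd.mpr hp)
  · have : ((p + q : ℕ) : ℂ) = (2 * N : ℕ) := by push_cast; linear_combination h / 2
    exact_mod_cast this

/-- Multiplication with the chirality matrix is the Hodge star up to signs. -/
lemma fierzMap_chirality_mul_eq_zero {p q : ℕ} (h : p + q ≠ 2 * N) {ω : Polyform N}
    (hω : ω ∈ ⋀[ℂ]^p (Idx N → ℂ)) : fierzMap q (chirality N * cliffordMap ω) = 0 := by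
  -- Chirality anticommutes with every `γ_i`, hence with `X ↦ γ_i X γ^i`, and therefore reverses the
  -- eigenvalue that detects the degree.
  have h1 := fierzMap_gammaSum q (chirality N * cliffordMap ω)
  rw [gammaSum_chirality_mul, gammaSum_cliffordMap hω, mul_smul_comm, map_neg, map_smul,
    ← sub_eq_zero, ← neg_smul, ← sub_smul] at h1
  refine (smul_eq_zero.mp h1).resolve_left fun h2 => h (degreeEigenvalue_add_eq_zero (N := N) ?_)
  linear_combination -h2

/-- Conjugation by chirality preserves the trace but reverses the sign of an odd product of gamma
matrices. -/
lemma fierzMap_of_odd {q : ℕ} (hq : Odd q) {X : Matrix (SpinIdx N) (SpinIdx N) ℂ}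
    (hX : chirality N * X = X * chirality N) : fierzMap q X = 0 := by
  rw [fierzMap_apply, Finset.sum_eq_zero, smul_zero]
  intro i _
  set Y := gammaProd (List.ofFn i).reverse
  have hY : chirality N * Y = -(Y * chirality N) := by
    rw [chirality_mul_gammaProd, List.length_reverse, List.length_ofFn, hq.neg_one_pow,
      neg_one_smul]
  have : (Y * X).trace = -(Y * X).trace := by
    calc (Y * X).trace = (chirality N * (chirality N * (Y * X))).trace := by
          rw [← mul_assoc, chirality_mul_self, one_mul]
      _ = (chirality N * (Y * X) * chirality N).trace := trace_mul_comm _ _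
      _ = (-(Y * X)).trace := by
          rw [← mul_assoc, hY, neg_mul, mul_assoc Y, hX, neg_mul, mul_assoc, mul_assoc,
            chirality_mul_self, mul_one]
      _ = _ := trace_neg _
  rw [self_eq_neg.mp this, zero_smul]

lemma cliffordMap_mul_gamma {q : ℕ} (m : Idx N) {ω : Polyform N}
    (hω : ω ∈ ⋀[ℂ]^q (Idx N → ℂ)) :
    cliffordMap ω * gamma m = (-1 : ℂ) ^ q •
      cliffordMap (ExteriorAlgebra.ι ℂ (dx m) * ω - contract (dotForm N (dx m)) ω) := by
  refine eqOn_exteriorPower (f := LinearMap.mulRight ℂ (gamma m) ∘ₗ cliffordMap)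
    (g := (-1 : ℂ) ^ q • cliffordMap ∘ₗ (LinearMap.mulLeft ℂ (ExteriorAlgebra.ι ℂ (dx m)) -
      contract (dotForm N (dx m)))) (fun i hi => ?_) hω
  set η := ExteriorAlgebra.ιMulti ℂ q (fun j => (dx (i j) : Idx N → ℂ))
  have hη : η = ((List.ofFn i).map fun i => ExteriorAlgebra.ι ℂ (dx i)).prod := ιMulti_dx i
  have hnd := List.nodup_ofFn.mpr hi
  change cliffordMap η * gamma m = (-1 : ℂ) ^ q •
      cliffordMap (ExteriorAlgebra.ι ℂ (dx m) * η - contract (dotForm N (dx m)) η)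
  have h1 := gammaLin_mul_cliffordMap (dx m) η
  rw [gammaLin_dx, cliffordMap_ιMulti_dx hi, gamma_mul_gammaProd, List.length_ofFn,
    List.Nodup.count hnd, ← cliffordMap_ιMulti_dx hi] at h1
  have hsq : (-1 : ℂ) ^ q * (-1) ^ q = 1 := by rw [← mul_pow]; simp
  -- If `m` occurs in the product the wedge term vanishes; otherwise the contraction does. Either
  -- way right multiplication follows from left multiplication and the sign of moving `γ_m` across.
  by_cases hm : m ∈ List.ofFn i
  · have h0 : ExteriorAlgebra.ι ℂ (dx m) * η = 0 := by
      obtain ⟨j, rfl⟩ := List.mem_ofFn' i m |>.mp hm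
      have := ExteriorAlgebra.ι_mul_prod_list (R := ℂ) (fun j => (dx (i j) : Idx N → ℂ)) j
      rw [← this]
      congr 1
    rw [if_pos hm, h0, zero_add, pow_add, pow_one, mul_neg_one, neg_smul] at h1
    rw [h0, zero_sub, map_neg, ← h1, neg_neg, smul_smul, hsq, one_smul]
  · have h0 : contract (dotForm N (dx m)) η = 0 := by
      rw [hη, show (fun i => ExteriorAlgebra.ι ℂ (dx i : Idx N → ℂ)) = ExteriorAlgebra.ι ℂ ∘ dx
        from rfl, ← List.map_map]
      refine contract_prod_eq_zero _ _ fun v hv => ?_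
      obtain ⟨j, hj, rfl⟩ := List.mem_map.mp hv
      rw [dotForm_apply, dx_dotProduct_dx, if_neg]
      rintro rfl
      exact hm hj
    rw [if_neg hm, h0, add_zero, add_zero] at h1
    rw [h0, sub_zero, ← h1, smul_smul, hsq, one_smul]

lemma cliffordMap_mul_gammaLin {q : ℕ} (v : Idx N → ℂ) {ω : Polyform N}
    (hω : ω ∈ ⋀[ℂ]^q (Idx N → ℂ)) :
    cliffordMap ω * gammaLin v = (-1 : ℂ) ^ q •
      cliffordMap (ExteriorAlgebra.ι ℂ v * ω - contract (dotForm N v) ω) := by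
  rw [gammaLin_apply, Finset.mul_sum]
  conv_rhs => rw [eq_sum_dx v]
  simp only [mul_smul_comm, cliffordMap_mul_gamma _ hω, map_sum, map_smul, LinearMap.sum_apply,
    LinearMap.smul_apply, Finset.sum_mul, smul_mul_assoc, map_sub, smul_sub, Finset.smul_sum,
    Finset.sum_sub_distrib, smul_comm ((-1 : ℂ) ^ q)]

/-- On even forms the sign `(-1)^q` disappears, which lets right multiplication be combined with
left multiplication to isolate the wedge product. -/
lemma cliffordMap_mul_gammaLin_of_even (v : Idx N → ℂ) {ω : Polyform N}
    (hω : ∀ q, Odd q → formPart q ω = 0) :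
    cliffordMap ω * gammaLin v =
      cliffordMap (ExteriorAlgebra.ι ℂ v * ω - contract (dotForm N v) ω) := by
  have h : ∀ q ∈ Finset.range (2 * N + 1), cliffordMap (formPart q ω) * gammaLin v =
      cliffordMap (ExteriorAlgebra.ι ℂ v * formPart q ω -
        contract (dotForm N v) (formPart q ω)) := by
    intro q _
    rcases Nat.even_or_odd q with he | ho
    · rw [cliffordMap_mul_gammaLin v (formPart_mem q ω), he.neg_one_pow, one_smul]
    · simp [hω q ho]
  have := Finset.sum_congr rfl h
  rw [← Finset.sum_mul, ← map_sum, ← map_sum, Finset.sum_sub_distrib, ← Finset.mul_sum,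
    ← map_sum, sum_formPart] at this
  exact this

/-! ### Isotropic subspaces -/

/-- Totally isotropic subspaces of the space of covectors. -/
def IsIsotropic (W : Submodule ℂ (Idx N → ℂ)) : Prop := ∀ v ∈ W, ∀ w ∈ W, v ⬝ᵥ w = 0

lemma dotForm_nondegenerate : (dotForm N).Nondegenerate := by
  rw [LinearMap.BilinForm.nondegenerate_iff_ker_eq_bot]
  rw [LinearMap.ker_eq_bot']
  intro v hv
  ext i
  have := LinearMap.congr_fun hv (dx i)
  rwa [dotForm_apply, dotProduct_comm, dx_dotProduct] at this

lemma mem_orthogonal {W : Submodule ℂ (Idx N → ℂ)} {v : Idx N → ℂ} :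
    v ∈ (dotForm N).orthogonal W ↔ ∀ w ∈ W, w ⬝ᵥ v = 0 := Iff.rfl

lemma finrank_covector : Module.finrank ℂ (Idx N → ℂ) = 2 * N := by
  simp [two_mul]

lemma finrank_orthogonal_add (W : Submodule ℂ (Idx N → ℂ)) :
    Module.finrank ℂ ((dotForm N).orthogonal W) + Module.finrank ℂ W = 2 * N := by
  rw [LinearMap.BilinForm.finrank_orthogonal dotForm_nondegenerate, finrank_covector]
  have := Submodule.finrank_le W
  rw [finrank_covector] at this
  omega

lemma IsIsotropic.le_orthogonal {W : Submodule ℂ (Idx N → ℂ)} (h : IsIsotropic W) :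
    W ≤ (dotForm N).orthogonal W := fun v hv w hw => h w hw v hv

lemma IsIsotropic.finrank_le {W : Submodule ℂ (Idx N → ℂ)} (h : IsIsotropic W) :
    Module.finrank ℂ W ≤ N := by
  have h1 := Submodule.finrank_mono h.le_orthogonal
  have h2 := finrank_orthogonal_add W
  omega

lemma IsIsotropic.orthogonal_eq {W : Submodule ℂ (Idx N → ℂ)} (h : IsIsotropic W)
    (hW : N ≤ Module.finrank ℂ W) : (dotForm N).orthogonal W = W := by
  refine (Submodule.eq_of_le_of_finrank_le h.le_orthogonal ?_).symm
  have := finrank_orthogonal_add W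
  omega

/-! ### Annihilators of spinors and purity -/

/-- The matrix with columns `γ_i η`. -/
def spinorFrame (η : Spinor N) : Matrix (SpinIdx N) (Idx N) ℂ := of fun s i => (gamma i *ᵥ η) s

lemma spinorFrame_mulVec (η : Spinor N) (v : Idx N → ℂ) :
    spinorFrame η *ᵥ v = gammaLin v *ᵥ η := by
  ext s
  rw [gammaLin_apply, Matrix.sum_mulVec, Finset.sum_apply]
  change ∑ i, (gamma i *ᵥ η) s * v i = _
  refine Finset.sum_congr rfl fun i _ => ?_
  rw [smul_mulVec, Pi.smul_apply, smul_eq_mul, mul_comm]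

/-- The space of covectors that annihilate a spinor. -/
def spinorAnn (η : Spinor N) : Submodule ℂ (Idx N → ℂ) := LinearMap.ker (spinorFrame η).mulVecLin

lemma mem_spinorAnn {η : Spinor N} {v : Idx N → ℂ} :
    v ∈ spinorAnn η ↔ gammaLin v *ᵥ η = 0 := by
  rw [spinorAnn, LinearMap.mem_ker, mulVecLin_apply, spinorFrame_mulVec]

/-- The anticommutator of two annihilating covectors acts as the scalar `2 v·w`, yet kills `η`. -/
lemma isIsotropic_spinorAnn {η : Spinor N} (hη : η ≠ 0) : IsIsotropic (spinorAnn η) := by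
  intro v hv w hw
  rw [mem_spinorAnn] at hv hw
  have h := congrArg (· *ᵥ η) (gammaLin_mul_add v w)
  simp only [add_mulVec, ← mulVec_mulVec, hv, hw, mulVec_zero, add_zero, smul_mulVec,
    one_mulVec] at h
  have := (smul_eq_zero.mp h.symm).resolve_right hη
  simpa using this

lemma gammaSum_vecMulVec (I J : Spinor N) :
    gammaSum (vecMulVec I (J ᵥ* conjB N)) = spinorFrame I * (spinorFrame J)ᵀ * conjB N := by
  have h : spinorFrame I * (spinorFrame J)ᵀ =
      ∑ i, vecMulVec (gamma i *ᵥ I) (gamma i *ᵥ J) := by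
    ext s t
    simp [spinorFrame, mul_apply, Matrix.sum_apply, vecMulVec_apply]
  rw [gammaSum_apply, h, Finset.sum_mul]
  refine Finset.sum_congr rfl fun i _ => ?_
  rw [vecMulVec_mul, mul_vecMulVec, vecMulVec_mul, vecMul_vecMul, ← gamma_transpose_mul_conjB,
    ← vecMul_vecMul, vecMul_transpose]

lemma mul_conjB_eq_zero {m : Type*} {X : Matrix m (SpinIdx N) ℂ} :
    X * conjB N = 0 ↔ X = 0 := by
  refine ⟨fun h => ?_, fun h => by rw [h, Matrix.zero_mul]⟩
  rw [← Matrix.mul_one X, ← conjB_mul_self, ← Matrix.mul_assoc, h, Matrix.zero_mul]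

lemma formPart_bispinor (q : ℕ) (I It : Spinor N) :
    formPart q (bispinor I It) = fierzMap q (vecMulVec I (It ᵥ* conjB N)) := by
  rw [formPart_eq_fierzMap, cliffordMap_bispinor]

/-- The eigenvalue of `X ↦ γ_i X γ^i` vanishes only in degree `N`. On the matrix of `I ⊗ Iᶜ` this
operator produces the frame times its transpose, up to the invertible `B`. -/
lemma purityRelation_iff (I : Spinor N) :
    PurityRelation I ↔ spinorFrame I * (spinorFrame I)ᵀ = 0 := by
  rw [← mul_conjB_eq_zero, ← gammaSum_vecMulVec]
  constructor
  · intro h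
    rw [← cliffordMap_sum_fierzMap (gammaSum _), Finset.sum_eq_zero, map_zero]
    intro q _
    rw [fierzMap_gammaSum, ← formPart_bispinor]
    by_cases hq : q = N
    · rw [(degreeEigenvalue_eq_zero_iff q).mpr hq, zero_smul]
    · rw [h q hq, smul_zero]
  · intro h q hq
    have := fierzMap_gammaSum q (vecMulVec I (I ᵥ* conjB N))
    rw [h, map_zero] at this
    rw [formPart_bispinor]
    exact (smul_eq_zero.mp this.symm).resolve_left
      fun h0 => hq ((degreeEigenvalue_eq_zero_iff q).mp h0)

/-- A spinor that satisfies the purity relation is annihilated by a subspace of dimension `N`. -/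
lemma PurityRelation.le_finrank_spinorAnn {η : Spinor N} (h : PurityRelation η) :
    N ≤ Module.finrank ℂ (spinorAnn η) := by
  rw [purityRelation_iff] at h
  -- With `F` the frame, `F Fᵗ = 0` gives `rank F = rank Fᵗ ≤ dim ker F`, while `rank F + dim ker F
  -- = 2N`.
  have h1 : LinearMap.range (spinorFrame η)ᵀ.mulVecLin ≤ spinorAnn η := by
    rintro _ ⟨u, rfl⟩
    rw [spinorAnn, LinearMap.mem_ker, mulVecLin_apply, mulVecLin_apply, mulVec_mulVec, h,
      zero_mulVec]
  have h2 := Submodule.finrank_mono h1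
  have h3 := (spinorFrame η).mulVecLin.finrank_range_add_finrank_ker
  have h4 : (spinorFrame η)ᵀ.rank = (spinorFrame η).rank := rank_transpose _
  rw [finrank_covector] at h3
  rw [rank, rank] at h4
  change _ ≤ Module.finrank ℂ (LinearMap.ker (spinorFrame η).mulVecLin)
  rw [spinorAnn] at h2
  omega

/-- The image of the transposed frame is orthogonal to the annihilator; in the maximal case the
annihilator is its own orthogonal complement, so it contains this image. -/
lemma purityRelation_of_le_finrank {η : Spinor N} (hη : η ≠ 0)
    (h : N ≤ Module.finrank ℂ (spinorAnn η)) : PurityRelation η := by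
  rw [purityRelation_iff]
  refine Matrix.ext_iff_mulVec.mpr fun u => ?_
  have h1 : (spinorFrame η)ᵀ *ᵥ u ∈ spinorAnn η := by
    rw [← (isIsotropic_spinorAnn hη).orthogonal_eq h, mem_orthogonal]
    intro w hw
    rw [spinorAnn, LinearMap.mem_ker, mulVecLin_apply] at hw
    rw [mulVec_transpose, dotProduct_comm, ← dotProduct_mulVec, hw, dotProduct_zero]
  rw [← mulVec_mulVec, zero_mulVec]
  exact h1

lemma purityRelation_zero : PurityRelation (0 : Spinor N) := by
  rw [purityRelation_iff]
  ext
  simp [spinorFrame, mul_apply]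

/-! ### Properties of bispinors -/

lemma bispinor_zero_left (It : Spinor N) : bispinor 0 It = 0 :=
  cliffordMap_injective (by rw [cliffordMap_bispinor, zero_vecMulVec, map_zero])

lemma bispinor_zero_right (I : Spinor N) : bispinor I 0 = 0 :=
  cliffordMap_injective (by rw [cliffordMap_bispinor, zero_vecMul, vecMulVec_zero, map_zero])

lemma bispinor_ne_zero {I It : Spinor N} (hI : I ≠ 0) (hIt : It ≠ 0) : bispinor I It ≠ 0 := by
  intro h
  have h1 := cliffordMap_bispinor I It
  rw [h, map_zero, ← vecMulVec_mul, eq_comm, mul_conjB_eq_zero] at h1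
  obtain ⟨s, hs⟩ := Function.ne_iff.mp hI
  obtain ⟨t, ht⟩ := Function.ne_iff.mp hIt
  exact mul_ne_zero hs ht (congrFun (congrFun h1 s) t)

lemma ι_mul_bispinor_add {I : Spinor N} (It : Spinor N) {v : Idx N → ℂ} (hv : v ∈ spinorAnn I) :
    ExteriorAlgebra.ι ℂ v * bispinor I It + contract (dotForm N v) (bispinor I It) = 0 := by
  apply cliffordMap_injective
  rw [← gammaLin_mul_cliffordMap, cliffordMap_bispinor, mul_vecMulVec, mem_spinorAnn.mp hv,
    zero_vecMulVec, map_zero]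

lemma formPart_bispinor_odd {I It : Spinor N} (hI : chirality N *ᵥ I = I)
    (hIt : chirality N *ᵥ It = (-1 : ℂ) ^ N • It) {q : ℕ} (hq : Odd q) :
    formPart q (bispinor I It) = 0 := by
  rw [formPart_bispinor]
  refine fierzMap_of_odd hq ?_
  rw [mul_vecMulVec, hI, vecMulVec_mul, vecMul_vecMul, conjB_mul_chirality, vecMul_smul,
    ← vecMul_vecMul, ← mulVec_transpose (chirality N), chirality_transpose, hIt, smul_vecMul,
    smul_smul, ← mul_pow]
  simp

lemma ι_mul_bispinor_sub {I It : Spinor N} (hI : chirality N *ᵥ I = I)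
    (hIt : chirality N *ᵥ It = (-1 : ℂ) ^ N • It) {v : Idx N → ℂ} (hv : v ∈ spinorAnn It) :
    ExteriorAlgebra.ι ℂ v * bispinor I It - contract (dotForm N v) (bispinor I It) = 0 := by
  apply cliffordMap_injective
  have hB : conjB N * gammaLin v = (gammaLin v)ᵀ * conjB N := by
    rw [gammaLin_apply, Finset.mul_sum, transpose_sum, Finset.sum_mul]
    refine Finset.sum_congr rfl fun i _ => ?_
    rw [transpose_smul, mul_smul_comm, smul_mul_assoc, gamma_transpose_mul_conjB]
  rw [← cliffordMap_mul_gammaLin_of_even v fun q hq => formPart_bispinor_odd hI hIt hq,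
    cliffordMap_bispinor, vecMulVec_mul, vecMul_vecMul, hB, ← vecMul_vecMul, vecMul_transpose,
    mem_spinorAnn.mp hv, zero_vecMul, vecMulVec_zero, map_zero]

/-- Adding the relations from the left and the right spinor cancels the contraction. This yields the
lower bounds on the type. -/
lemma ι_mul_bispinor_of_mem {I It : Spinor N} (hI : chirality N *ᵥ I = I)
    (hIt : chirality N *ᵥ It = (-1 : ℂ) ^ N • It) {v : Idx N → ℂ}
    (hv : v ∈ spinorAnn I ⊓ spinorAnn It) : ExteriorAlgebra.ι ℂ v * bispinor I It = 0 := by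
  have h := congrArg₂ (· + ·) (ι_mul_bispinor_add It hv.1) (ι_mul_bispinor_sub hI hIt hv.2)
  rw [add_add_sub_cancel, add_zero, ← two_smul ℂ] at h
  exact (smul_eq_zero.mp h).resolve_left two_ne_zero

/-- A nonzero bispinor of a chiral spinor has a nonzero part of degree at most `N`. -/
lemma exists_formPart_bispinor_ne_zero {I It : Spinor N} (hI : chirality N *ᵥ I = I)
    (hI0 : I ≠ 0) (hIt0 : It ≠ 0) : ∃ q ≤ N, formPart q (bispinor I It) ≠ 0 := by
  by_contra! hcon
  apply bispinor_ne_zero hI0 hIt0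
  refine polyform_ext fun q => ?_
  rw [formPart_zero]
  by_cases hq : q ≤ N
  · exact hcon q hq
  -- `Φ` is fixed by chirality, which sends degree `p` to degree `2N - p`. Parts above degree `N`
  -- can only come from parts below `N`, assumed zero.
  have h1 : chirality N * cliffordMap (bispinor I It) = cliffordMap (bispinor I It) := by
    rw [cliffordMap_bispinor, mul_vecMulVec, hI]
  rw [formPart_eq_fierzMap, ← h1]
  conv_lhs => rw [← sum_formPart (bispinor I It), map_sum, Finset.mul_sum, map_sum]
  refine Finset.sum_eq_zero fun p _ => ?_
  by_cases hp : p ≤ N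
  · rw [hcon p hp, map_zero, mul_zero, map_zero]
  · exact fierzMap_chirality_mul_eq_zero (by omega) (formPart_mem p _)

/-! ### Polyforms annihilated by wedge products -/

lemma exists_dual_of_linearIndependent {ι : Type*} {w : ι → Idx N → ℂ}
    (hw : LinearIndependent ℂ w) : ∃ f : ι → Module.Dual ℂ (Idx N → ℂ),
      ∀ a b, f a (w b) = Finsupp.single b (1 : ℂ) a := by
  obtain ⟨g, hg⟩ := LinearMap.exists_extend hw.repr
  refine ⟨fun a => Finsupp.lapply a ∘ₗ g, fun a b => ?_⟩
  have hb : w b ∈ Submodule.span ℂ (Set.range w) := Submodule.subset_span ⟨b, rfl⟩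
  have := LinearMap.congr_fun hg ⟨w b, hb⟩
  simp only [LinearMap.comp_apply, Submodule.subtype_apply] at this
  rw [LinearMap.comp_apply, this, hw.repr_eq_single b ⟨w b, hb⟩ rfl, Finsupp.lapply_apply]

lemma ι_mul_contract {f : Module.Dual ℂ (Idx N → ℂ)} {v : Idx N → ℂ} {ω : Polyform N}
    (h : ExteriorAlgebra.ι ℂ v * ω = 0) : ExteriorAlgebra.ι ℂ v * contract f ω = f v • ω := by
  have := contract_ι_mul f v ω
  rw [h, map_zero] at this
  exact (sub_eq_zero.mp this.symm).symm

/-- With `f` dual to the first covector, `ω = w_0 ∧ (f⌟ω)`, and `f⌟ω` is still annihilated by the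
remaining covectors. -/
lemma exists_eq_prod_mul {m : ℕ} {w : Fin m → Idx N → ℂ} (hw : LinearIndependent ℂ w)
    {ω : Polyform N} (h : ∀ a, ExteriorAlgebra.ι ℂ (w a) * ω = 0) :
    ∃ ω', ω = ((List.ofFn w).map (ExteriorAlgebra.ι ℂ)).prod * ω' := by
  induction m generalizing ω with
  | zero => exact ⟨ω, by simp⟩
  | succ m ih =>
    obtain ⟨f, hf⟩ := exists_dual_of_linearIndependent hw
    obtain ⟨ω', h'⟩ := ih (w := fun a => w a.succ) (hw.comp _ (Fin.succ_injective m))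
      (ω := contract (f 0) ω) fun a => by
        rw [ι_mul_contract (h a.succ), hf, Finsupp.single_eq_of_ne (Fin.succ_ne_zero a).symm,
          zero_smul]
    refine ⟨ω', ?_⟩
    rw [List.ofFn_succ, List.map_cons, List.prod_cons, mul_assoc, ← h', ι_mul_contract (h 0), hf,
      Finsupp.single_eq_same, one_smul]

lemma formPart_eq_zero_of_lt_finrank {K : Submodule ℂ (Idx N → ℂ)} {ω : Polyform N}
    (h : ∀ v ∈ K, ExteriorAlgebra.ι ℂ v * ω = 0) {q : ℕ} (hq : q < Module.finrank ℂ K) :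
    formPart q ω = 0 := by
  have b := Module.finBasis ℂ K
  have hb : LinearIndependent ℂ fun a => (b a : Idx N → ℂ) :=
    b.linearIndependent.map' K.subtype K.ker_subtype
  obtain ⟨ω', rfl⟩ := exists_eq_prod_mul hb fun a => h _ (b a).2
  refine formPart_mul_of_lt (prod_ι_mem_exteriorPower _) ?_ _
  rwa [List.length_ofFn]

/-! ### The degree operator and exponentials -/

/-- The degree operator, written in terms of a basis. -/
def degreeOp {ι : Type*} [Fintype ι] (b : Module.Basis ι ℂ (Idx N → ℂ)) :
    Polyform N →ₗ[ℂ] Polyform N :=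
  ∑ i, LinearMap.mulLeft ℂ (ExteriorAlgebra.ι ℂ (b i)) ∘ₗ contract (b.coord i)

lemma degreeOp_apply {ι : Type*} [Fintype ι] (b : Module.Basis ι ℂ (Idx N → ℂ)) (ω : Polyform N) :
    degreeOp b ω = ∑ i, ExteriorAlgebra.ι ℂ (b i) * contract (b.coord i) ω := by
  simp [degreeOp]

lemma ι_mul_ι_anticomm (v w : Idx N → ℂ) :
    ExteriorAlgebra.ι ℂ v * ExteriorAlgebra.ι ℂ w =
      -(ExteriorAlgebra.ι ℂ w * ExteriorAlgebra.ι ℂ v) :=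
  eq_neg_of_add_eq_zero_left (ExteriorAlgebra.ι_add_mul_swap v w)

lemma degreeOp_ι_mul {ι : Type*} [Fintype ι] (b : Module.Basis ι ℂ (Idx N → ℂ)) (v : Idx N → ℂ)
    (ω : Polyform N) : degreeOp b (ExteriorAlgebra.ι ℂ v * ω) =
      ExteriorAlgebra.ι ℂ v * ω + ExteriorAlgebra.ι ℂ v * degreeOp b ω := by
  have h : ∀ i, ExteriorAlgebra.ι ℂ (b i) * contract (b.coord i) (ExteriorAlgebra.ι ℂ v * ω) =
      ExteriorAlgebra.ι ℂ (b.coord i v • b i) * ω +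
        ExteriorAlgebra.ι ℂ v * (ExteriorAlgebra.ι ℂ (b i) * contract (b.coord i) ω) := by
    intro i
    rw [contract_ι_mul, mul_sub, mul_smul_comm, map_smul, smul_mul_assoc, ← mul_assoc,
      ι_mul_ι_anticomm, neg_mul, sub_neg_eq_add, mul_assoc]
  rw [degreeOp_apply, degreeOp_apply, Finset.sum_congr rfl fun i _ => h i,
    Finset.sum_add_distrib, ← Finset.sum_mul, ← map_sum, ← Finset.mul_sum]
  congr 3
  exact b.sum_repr v

lemma degreeOp_prod {ι : Type*} [Fintype ι] (b : Module.Basis ι ℂ (Idx N → ℂ))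
    (l : List (Idx N → ℂ)) : degreeOp b (l.map (ExteriorAlgebra.ι ℂ)).prod =
      (l.length : ℂ) • (l.map (ExteriorAlgebra.ι ℂ)).prod := by
  induction l with
  | nil => simp [degreeOp_apply]
  | cons v l ih =>
    rw [List.map_cons, List.prod_cons, degreeOp_ι_mul, ih, List.length_cons, Nat.cast_succ,
      add_smul, one_smul, mul_smul_comm, add_comm]

lemma degreeOp_of_mem {ι : Type*} [Fintype ι] (b : Module.Basis ι ℂ (Idx N → ℂ)) {q : ℕ}
    {ω : Polyform N} (hω : ω ∈ ⋀[ℂ]^q (Idx N → ℂ)) : degreeOp b ω = (q : ℂ) • ω := by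
  refine eqOn_exteriorPower (f := degreeOp b) (g := (q : ℂ) • LinearMap.id) (fun i _ => ?_) hω
  have h := degreeOp_prod b (List.ofFn fun j => dx (i j))
  rw [List.length_ofFn, List.map_ofFn] at h
  rw [ExteriorAlgebra.ιMulti_apply]
  exact h

lemma formPart_degreeOp {ι : Type*} [Fintype ι] (b : Module.Basis ι ℂ (Idx N → ℂ)) (q : ℕ)
    (ω : Polyform N) : formPart q (degreeOp b ω) = (q : ℂ) • formPart q ω := by
  induction ω using polyform_induction with
  | h0 => simp [formPart_zero]
  | hadd x y hx hy => rw [map_add, formPart_add, formPart_add, hx, hy, smul_add]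
  | h p ω hω =>
    rw [degreeOp_of_mem b hω, formPart_smul, formPart_of_mem q hω]
    split_ifs with h
    · rw [h]
    · simp

/-- In a basis adapted to `K` and a complement, each basis vector of `K` contributes `ω` to the
degree operator, and each vector `b_j` of the complement contributes `b_j ∧ x_j ∧ ω`. Half the sum
of the `b_j ∧ x_j` is `β`. -/
lemma exists_twoForm_formPart_eq {K : Submodule ℂ (Idx N → ℂ)} {ω : Polyform N}
    (hK : ∀ v ∈ K, ExteriorAlgebra.ι ℂ v * ω = 0)
    (hf : ∀ f ∈ K.dualAnnihilator, ∃ x, contract f ω = ExteriorAlgebra.ι ℂ x * ω) :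
    ∃ β ∈ ⋀[ℂ]^2 (Idx N → ℂ), ∀ q : ℕ,
      ((q : ℂ) - Module.finrank ℂ K) • formPart q ω = (2 : ℂ) • formPart q (β * ω) := by
  obtain ⟨K', hKK'⟩ := Submodule.exists_isCompl K
  let b := ((Module.finBasis ℂ K).prod (Module.finBasis ℂ K')).map
    (Submodule.prodEquivOfIsCompl K K' hKK')
  have hbl : ∀ a, b (Sum.inl a) = (Module.finBasis ℂ K a : Idx N → ℂ) := fun a => by simp [b]
  have hbr : ∀ j, b.coord (Sum.inr j) ∈ K.dualAnnihilator := by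
    intro j
    rw [Submodule.mem_dualAnnihilator]
    intro v hv
    have : (Submodule.prodEquivOfIsCompl K K' hKK').symm v = (⟨v, hv⟩, 0) :=
      Submodule.prodEquivOfIsCompl_symm_apply_left _ _ hKK' ⟨v, hv⟩
    simp [b, this]
  choose x hx using fun j => hf _ (hbr j)
  refine ⟨(2⁻¹ : ℂ) • ∑ j, ExteriorAlgebra.ι ℂ (b (Sum.inr j)) * ExteriorAlgebra.ι ℂ (x j),
    Submodule.smul_mem _ _ (Submodule.sum_mem _ fun j _ =>
      mul_mem_exteriorPower (ι_mem_exteriorPower_one _) (ι_mem_exteriorPower_one _)),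
    fun q => ?_⟩
  have hl : ∀ a, ExteriorAlgebra.ι ℂ (b (Sum.inl a)) * contract (b.coord (Sum.inl a)) ω = ω := by
    intro a
    rw [ι_mul_contract (hK _ (by rw [hbl]; exact SetLike.coe_mem _))]
    simp
  rw [sub_smul, ← formPart_degreeOp b, degreeOp_apply, Fintype.sum_sum_type,
    Finset.sum_congr rfl fun a _ => hl a, smul_mul_assoc, formPart_smul, smul_smul,
    mul_inv_cancel₀ two_ne_zero, one_smul, formPart_add, Finset.sum_const, Finset.card_univ,
    Fintype.card_fin, ← Nat.cast_smul_eq_nsmul ℂ, formPart_smul, add_sub_cancel_left,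
    Finset.sum_mul]
  simp_rw [hx, mul_assoc]

lemma commute_of_mem_two {β : Polyform N} (hβ : β ∈ ⋀[ℂ]^2 (Idx N → ℂ)) (ω : Polyform N) :
    Commute β ω := by
  have hv : ∀ v, β * ExteriorAlgebra.ι ℂ v = ExteriorAlgebra.ι ℂ v * β := by
    intro v
    refine eqOn_exteriorPower (f := LinearMap.mulRight ℂ (ExteriorAlgebra.ι ℂ v))
      (g := LinearMap.mulLeft ℂ (ExteriorAlgebra.ι ℂ v)) (fun i _ => ?_) hβ
    rw [ExteriorAlgebra.ιMulti_apply]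
    simp only [List.ofFn_succ, List.ofFn_zero, List.prod_cons, List.prod_nil, mul_one,
      LinearMap.mulRight_apply, LinearMap.mulLeft_apply]
    rw [mul_assoc, ι_mul_ι_anticomm _ v, mul_neg, ← mul_assoc, ι_mul_ι_anticomm _ v, neg_mul,
      neg_neg, mul_assoc]
  induction ω using ExteriorAlgebra.induction with
  | algebraMap r => exact (Algebra.commutes r β).symm
  | ι v => exact hv v
  | mul x y hx hy => exact hx.mul_right hy
  | add x y hx hy => exact hx.add_right hy

lemma pow_mem_exteriorPower {p : ℕ} {β : Polyform N} (hβ : β ∈ ⋀[ℂ]^p (Idx N → ℂ)) (m : ℕ) :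
    β ^ m ∈ ⋀[ℂ]^(m * p) (Idx N → ℂ) := by
  have := SetLike.pow_mem_graded (A := fun n : ℕ => ⋀[ℂ]^n (Idx N → ℂ)) m hβ
  rwa [smul_eq_mul] at this

/-- The hypothesis is a recursion in steps of two degrees: it multiplies by `β/(m+1)` from degree `t
+ 2m` to the next, and it forces zero along the degrees `t + 1, t + 3, …`. -/
lemma eq_formPart_mul_expForm {t : ℕ} {β ω : Polyform N} (hβ : β ∈ ⋀[ℂ]^2 (Idx N → ℂ))
    (h : ∀ q : ℕ, ((q : ℂ) - t) • formPart q ω = (2 : ℂ) • formPart q (β * ω))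
    (hlt : ∀ q < t, formPart q ω = 0) : ω = formPart t ω * expForm β := by
  have hstep : ∀ q : ℕ, ((q + 2 : ℂ) - t) • formPart (q + 2) ω = (2 : ℂ) • (β * formPart q ω) := by
    intro q
    have := h (q + 2)
    rw [formPart_mul_of_le hβ (by omega), Nat.add_sub_cancel] at this
    exact_mod_cast this
  have heven : ∀ m, formPart (t + 2 * m) ω = ((m.factorial : ℂ)⁻¹) • (formPart t ω * β ^ m) := by
    intro m
    induction m with
    | zero => simp
    | succ m ih =>
      have h1 := hstep (t + 2 * m)
      rw [ih, mul_smul_comm, smul_smul, (commute_of_mem_two hβ _).eq, mul_assoc, ← pow_succ] at h1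
      have h2 : ((t + 2 * m : ℕ) + 2 : ℂ) - t = 2 * (m + 1) := by push_cast; ring
      rw [h2] at h1
      have hm : (2 * (m + 1) : ℂ) ≠ 0 := mul_ne_zero two_ne_zero (by exact_mod_cast m.succ_ne_zero)
      rw [show t + 2 * (m + 1) = t + 2 * m + 2 by ring]
      refine smul_right_injective _ hm ?_
      simp only
      rw [h1, smul_smul]
      congr 1
      rw [Nat.factorial_succ]
      push_cast
      have hm1 : (m + 1 : ℂ) ≠ 0 := by exact_mod_cast m.succ_ne_zero
      have hm2 : (m.factorial : ℂ) ≠ 0 := by exact_mod_cast m.factorial_ne_zero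
      field_simp
  have hodd : ∀ m, formPart (t + 2 * m + 1) ω = 0 := by
    intro m
    induction m with
    | zero =>
      have h1 := h (t + 1)
      have h2 : formPart (t + 1) (β * ω) = 0 := by
        rcases t with _ | t
        · exact formPart_mul_of_lt hβ (by omega) _
        · rw [formPart_mul_of_le hβ (by omega), hlt _ (by omega), mul_zero]
      rw [h2] at h1
      simpa using h1
    | succ m ih =>
      have h1 := hstep (t + 2 * m + 1)
      rw [ih, mul_zero, smul_zero] at h1
      rw [show t + 2 * (m + 1) + 1 = t + 2 * m + 1 + 2 by ring]
      refine (smul_eq_zero.mp h1).resolve_left ?_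
      have h2 : ((t + 2 * m + 1 : ℕ) + 2 : ℂ) - t = ((2 * m + 3 : ℕ) : ℂ) := by push_cast; ring
      rw [h2]
      exact_mod_cast (by omega : 2 * m + 3 ≠ 0)
  have hmem : ∀ m, (formPart t ω * β ^ m) ∈ ⋀[ℂ]^(t + m * 2) (Idx N → ℂ) := fun m =>
    mul_mem_exteriorPower (formPart_mem t ω) (pow_mem_exteriorPower hβ m)
  refine polyform_ext fun q => ?_
  rw [expForm, Finset.mul_sum, formPart_sum]
  simp_rw [mul_smul_comm, formPart_smul, formPart_of_mem q (hmem _)]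
  rcases lt_or_ge q t with hq | hq
  · rw [hlt q hq, Finset.sum_eq_zero]
    intro m _
    rw [if_neg (by omega), smul_zero]
  obtain ⟨r, rfl⟩ := Nat.exists_eq_add_of_le hq
  rcases Nat.even_or_odd' r with ⟨m, rfl | rfl⟩
  · rw [heven]
    by_cases hm : m ≤ N
    · rw [Finset.sum_eq_single_of_mem m (Finset.mem_range.mpr (by omega))
        fun m' _ hm' => by rw [if_neg (by omega), smul_zero]]
      rw [if_pos (by ring)]
    -- Beyond `m = N` the degree exceeds `2N`, so truncating the exponential loses nothing.
    · rw [Finset.sum_eq_zero fun m' hm' => by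
        rw [Finset.mem_range] at hm'
        rw [if_neg (by omega), smul_zero], ← heven]
      exact formPart_eq_zero_of_lt (by omega) _
  · rw [← add_assoc, hodd, Finset.sum_eq_zero]
    intro m' _
    rw [if_neg (by omega), smul_zero]

/-- The bispinor of two spinors that satisfy the purity relation. -/
lemma exists_bispinor_eq_formPart_mul_expForm {I It : Spinor N} (hI : chirality N *ᵥ I = I)
    (hIt : chirality N *ᵥ It = (-1 : ℂ) ^ N • It) (hI0 : I ≠ 0) (hIt0 : It ≠ 0)
    (hpI : PurityRelation I) (hpIt : PurityRelation It) :
    ∃ β ∈ ⋀[ℂ]^2 (Idx N → ℂ), bispinor I It =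
      formPart (Module.finrank ℂ ↥(spinorAnn I ⊓ spinorAnn It)) (bispinor I It) * expForm β := by
  set K := spinorAnn I ⊓ spinorAnn It
  have hK : ∀ v ∈ K, ExteriorAlgebra.ι ℂ v * bispinor I It = 0 := fun v hv =>
    ι_mul_bispinor_of_mem hI hIt hv
  -- A pure spinor's annihilator is its own orthogonal complement, so the functionals vanishing on
  -- it are dot products with its own elements.
  have hdual : ∀ {η : Spinor N}, η ≠ 0 → PurityRelation η →
      ∀ f ∈ (spinorAnn η).dualAnnihilator, ∃ x ∈ spinorAnn η, f = dotForm N x := by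
    intro η hη hp f hf
    obtain ⟨x, rfl⟩ := (dotForm N).toDual dotForm_nondegenerate |>.surjective f
    refine ⟨x, ?_, rfl⟩
    rw [← (isIsotropic_spinorAnn hη).orthogonal_eq hp.le_finrank_spinorAnn, mem_orthogonal]
    intro w hw
    rw [dotProduct_comm]
    exact (Submodule.mem_dualAnnihilator _).mp hf w hw
  obtain ⟨β, hβ, h⟩ := exists_twoForm_formPart_eq hK fun f hf => by
    rw [Subspace.dualAnnihilator_inf_eq] at hf
    obtain ⟨f₁, h₁, f₂, h₂, rfl⟩ := Submodule.mem_sup.mp hf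
    obtain ⟨x₁, hx₁, rfl⟩ := hdual hI0 hpI _ h₁
    obtain ⟨x₂, hx₂, rfl⟩ := hdual hIt0 hpIt _ h₂
    -- The left relation gives `x₁⌟Φ = -x₁ ∧ Φ`, the right one `x₂⌟Φ = x₂ ∧ Φ`.
    refine ⟨x₂ - x₁, ?_⟩
    have e₁ := ι_mul_bispinor_add It hx₁
    have e₂ := ι_mul_bispinor_sub hI hIt hx₂
    rw [contract, map_add, LinearMap.add_apply, map_sub, sub_mul, sub_eq_zero.mp e₂,
      eq_neg_of_add_eq_zero_left e₁, sub_neg_eq_add, add_comm]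
  exact ⟨β, hβ, eq_formPart_mul_expForm hβ h fun q hq => formPart_eq_zero_of_lt_finrank hK hq⟩

/-! ### Normal form of antisymmetric matrices -/

lemma wedgeMatrix_mulVec (u v x : Idx N → ℂ) :
    wedgeMatrix u v *ᵥ x = (v ⬝ᵥ x) • u - (u ⬝ᵥ x) • v := by
  rw [wedgeMatrix, sub_mulVec, vecMulVec_mulVec, vecMulVec_mulVec]
  ext i
  simp

lemma wedgeMatrix_transpose (u v : Idx N → ℂ) : (wedgeMatrix u v)ᵀ = -wedgeMatrix u v := by
  ext i j
  simp [wedgeMatrix, vecMulVec_apply]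
  ring

lemma sum_wedgeMatrix_mulVec {ι : Type*} [Fintype ι] (u v : ι → Idx N → ℂ) (x : Idx N → ℂ) :
    (∑ a, wedgeMatrix (u a) (v a)) *ᵥ x = ∑ a, ((v a ⬝ᵥ x) • u a - (u a ⬝ᵥ x) • v a) := by
  rw [Matrix.sum_mulVec]
  simp_rw [wedgeMatrix_mulVec]

lemma dotProduct_mulVec_antisymm {M : Matrix (Idx N) (Idx N) ℂ} (hM : Mᵀ = -M)
    (x y : Idx N → ℂ) : x ⬝ᵥ (M *ᵥ y) = -((M *ᵥ x) ⬝ᵥ y) := by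
  rw [dotProduct_mulVec, ← mulVec_transpose, hM, neg_mulVec, neg_dotProduct]

lemma dotProduct_mulVec_self_eq_zero {M : Matrix (Idx N) (Idx N) ℂ} (hM : Mᵀ = -M)
    (x : Idx N → ℂ) : x ⬝ᵥ (M *ᵥ x) = 0 := by
  have := dotProduct_mulVec_antisymm hM x x
  rw [dotProduct_comm (M *ᵥ x)] at this
  exact self_eq_neg.mp this

lemma exists_dotProduct_of_linearIndependent {ι : Type*} {w : ι → Idx N → ℂ}
    (hw : LinearIndependent ℂ w) : ∃ p : ι → Idx N → ℂ,
      ∀ a b, p a ⬝ᵥ w b = Finsupp.single b (1 : ℂ) a := by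
  obtain ⟨f, hf⟩ := exists_dual_of_linearIndependent hw
  refine ⟨fun a => ((dotForm N).toDual dotForm_nondegenerate).symm (f a), fun a b => ?_⟩
  rw [← hf, ← dotForm_apply]
  exact LinearMap.BilinForm.apply_toDual_symm_apply _ _

lemma range_sum_wedgeMatrix {ι : Type*} [Fintype ι] {u v : ι → Idx N → ℂ}
    (h : LinearIndependent ℂ (Sum.elim u v)) :
    LinearMap.range (∑ a, wedgeMatrix (u a) (v a)).mulVecLin =
      Submodule.span ℂ (Set.range (Sum.elim u v)) := by
  classical
  apply le_antisymm
  · rintro _ ⟨x, rfl⟩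
    rw [mulVecLin_apply, sum_wedgeMatrix_mulVec]
    refine Submodule.sum_mem _ fun a _ => Submodule.sub_mem _ (Submodule.smul_mem _ _ ?_)
      (Submodule.smul_mem _ _ ?_)
    · exact Submodule.subset_span ⟨Sum.inl a, rfl⟩
    · exact Submodule.subset_span ⟨Sum.inr a, rfl⟩
  · obtain ⟨p, hp⟩ := exists_dotProduct_of_linearIndependent h
    rw [Submodule.span_le]
    have hu : ∀ i a, u a ⬝ᵥ p i = Finsupp.single (Sum.inl a) (1 : ℂ) i := fun i a => by
      rw [dotProduct_comm]; exact hp i (Sum.inl a)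
    have hv : ∀ i a, v a ⬝ᵥ p i = Finsupp.single (Sum.inr a) (1 : ℂ) i := fun i a => by
      rw [dotProduct_comm]; exact hp i (Sum.inr a)
    rintro _ ⟨a | a, rfl⟩
    · refine ⟨p (Sum.inr a), ?_⟩
      rw [mulVecLin_apply, sum_wedgeMatrix_mulVec, Finset.sum_eq_single a]
      · simp [hu, hv]
      · intro b _ hb
        simp [hu, hv, hb]
      · simp
    · refine ⟨-p (Sum.inl a), ?_⟩
      rw [mulVecLin_apply, sum_wedgeMatrix_mulVec, Finset.sum_eq_single a]
      · simp [hu, hv]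
      · intro b _ hb
        simp [hu, hv, hb]
      · simp

lemma rank_sum_wedgeMatrix {m : ℕ} {u v : Fin m → Idx N → ℂ}
    (h : LinearIndependent ℂ (Sum.elim u v)) :
    (∑ a, wedgeMatrix (u a) (v a)).rank = 2 * m := by
  rw [rank, range_sum_wedgeMatrix h, finrank_span_eq_card h]
  simp [two_mul]

/-- The normal form of an antisymmetric matrix. -/
lemma exists_eq_sum_wedgeMatrix (M : Matrix (Idx N) (Idx N) ℂ) (hM : Mᵀ = -M) :
    ∃ (m : ℕ) (u v : Fin m → Idx N → ℂ), M = ∑ a, wedgeMatrix (u a) (v a) ∧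
      LinearIndependent ℂ (Sum.elim u v) := by
  induction hr : M.rank using Nat.strong_induction_on generalizing M with
  | h r ih =>
  by_cases h0 : M = 0
  · exact ⟨0, Fin.elim0, Fin.elim0, by simp [h0], linearIndependent_empty_type⟩
  obtain ⟨x, y, hxy⟩ : ∃ x y, x ⬝ᵥ (M *ᵥ y) ≠ 0 := by
    by_contra! hcon
    refine h0 (Matrix.ext_iff_mulVec.mpr fun y => ?_)
    rw [zero_mulVec]
    exact dotProduct_eq_zero _ fun x => by rw [dotProduct_comm]; exact hcon x y
  set c := x ⬝ᵥ (M *ᵥ y) with hc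
  set u₀ := M *ᵥ x
  set v₀ := c⁻¹ • (M *ᵥ y)
  have hxu : u₀ ⬝ᵥ x = 0 := by rw [dotProduct_comm, dotProduct_mulVec_self_eq_zero hM]
  have hxv : v₀ ⬝ᵥ x = 1 := by
    rw [smul_dotProduct, dotProduct_comm, ← hc, smul_eq_mul, inv_mul_cancel₀ hxy]
  have hyu : u₀ ⬝ᵥ y = -c := by rw [hc, dotProduct_mulVec_antisymm hM, neg_neg]
  have hyv : v₀ ⬝ᵥ y = 0 := by
    rw [smul_dotProduct, dotProduct_comm, dotProduct_mulVec_self_eq_zero hM, smul_zero]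
  -- Symplectic Gram-Schmidt: the remainder kills `x` and `y`, so its image is orthogonal to both.
  -- That image lies in the image of `M` but misses `u₀`, which pairs nontrivially with `y`; hence
  -- the rank drops.
  set M' := M - wedgeMatrix u₀ v₀ with hM'
  have hMt : M'ᵀ = -M' := by
    rw [hM', transpose_sub, hM, wedgeMatrix_transpose]
    abel
  have hx : M' *ᵥ x = 0 := by
    rw [hM', sub_mulVec, wedgeMatrix_mulVec, hxu, hxv, one_smul, zero_smul, sub_zero]
    exact sub_self _
  have hy : M' *ᵥ y = 0 := by
    rw [hM', sub_mulVec, wedgeMatrix_mulVec, hyu, hyv, zero_smul, zero_sub, neg_smul, neg_neg,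
      smul_smul, mul_inv_cancel₀ hxy, one_smul, sub_self]
  have hperp : ∀ {z}, M' *ᵥ z = 0 → ∀ w ∈ LinearMap.range M'.mulVecLin, w ⬝ᵥ z = 0 := by
    rintro z hz _ ⟨w, rfl⟩
    rw [mulVecLin_apply, ← neg_eq_zero, ← dotProduct_mulVec_antisymm hMt, hz, dotProduct_zero]
  have hle : LinearMap.range M'.mulVecLin < LinearMap.range M.mulVecLin := by
    refine lt_of_le_of_ne ?_ fun heq => ?_
    · rintro _ ⟨z, rfl⟩
      rw [mulVecLin_apply, hM', sub_mulVec, wedgeMatrix_mulVec]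
      refine Submodule.sub_mem _ ⟨z, rfl⟩ (Submodule.sub_mem _ (Submodule.smul_mem _ _ ⟨x, rfl⟩)
        (Submodule.smul_mem _ _ (Submodule.smul_mem _ _ ⟨y, rfl⟩)))
    · have := hperp hy u₀ (heq ▸ ⟨x, rfl⟩)
      rw [hyu, neg_eq_zero] at this
      exact hxy this
  obtain ⟨m, u, v, hMuv, hli⟩ := ih M'.rank
    (by rw [← hr]; exact Submodule.finrank_lt_finrank_of_lt hle) M' hMt rfl
  refine ⟨m + 1, Fin.cons u₀ u, Fin.cons v₀ v, ?_, ?_⟩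
  · rw [Fin.sum_univ_succ]
    simp only [Fin.cons_zero, Fin.cons_succ]
    rw [← hMuv, hM']
    abel
  · have hmem : ∀ i, Sum.elim u v i ∈ LinearMap.range M'.mulVecLin := fun i => by
      rw [hMuv, range_sum_wedgeMatrix hli]
      exact Submodule.subset_span ⟨i, rfl⟩
    rw [Fintype.linearIndependent_iff] at hli ⊢
    intro g hg
    simp only [Fintype.sum_sum_type, Fin.sum_univ_succ, Sum.elim_inl, Sum.elim_inr, Fin.cons_zero,
      Fin.cons_succ] at hg
    -- Pairing the linear relation with `x` and `y` isolates the coefficients of `v₀` and `u₀`.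
    have hdot : ∀ z, M' *ᵥ z = 0 →
        g (Sum.inl 0) * (u₀ ⬝ᵥ z) + g (Sum.inr 0) * (v₀ ⬝ᵥ z) = 0 := by
      intro z hz
      have h1 : ∀ a, u a ⬝ᵥ z = 0 := fun a => hperp hz _ (hmem (Sum.inl a))
      have h2 : ∀ a, v a ⬝ᵥ z = 0 := fun a => hperp hz _ (hmem (Sum.inr a))
      have := congrArg (· ⬝ᵥ z) hg
      simpa [add_dotProduct, sum_dotProduct, smul_dotProduct, h1, h2] using this
    have hg1 : g (Sum.inr 0) = 0 := by
      have := hdot x hx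
      rwa [hxu, hxv, mul_zero, zero_add, mul_one] at this
    have hg2 : g (Sum.inl 0) = 0 := by
      have := hdot y hy
      rw [hyu, hyv, mul_zero, add_zero] at this
      exact (mul_eq_zero.mp this).resolve_right (neg_ne_zero.mpr hxy)
    have hrest := hli (fun i => g (Sum.map Fin.succ Fin.succ i)) (by
      rw [hg1, hg2, zero_smul, zero_smul, zero_add, zero_add] at hg
      simpa [Fintype.sum_sum_type] using hg)
    rintro (a | a)
    · refine Fin.cases hg2 (fun a => hrest (Sum.inl a)) a
    · refine Fin.cases hg1 (fun a => hrest (Sum.inr a)) a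

/-! ### Powers of two-forms -/

lemma twoForm_sum {ι : Type*} (s : Finset ι) (M : ι → Matrix (Idx N) (Idx N) ℂ) :
    twoForm (∑ a ∈ s, M a) = ∑ a ∈ s, twoForm (M a) := by
  classical
  induction s using Finset.induction_on with
  | empty => simp [twoForm]
  | insert a s ha ih =>
    rw [Finset.sum_insert ha, Finset.sum_insert ha, ← ih]
    simp only [twoForm, Matrix.add_apply, add_smul, Finset.sum_add_distrib, smul_add]

lemma twoForm_wedgeMatrix (u v : Idx N → ℂ) :
    twoForm (wedgeMatrix u v) = ExteriorAlgebra.ι ℂ u * ExteriorAlgebra.ι ℂ v := by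
  have h : ∀ u v : Idx N → ℂ, ∑ i, ∑ j, (u i * v j) •
      (ExteriorAlgebra.ι ℂ (dx i : Idx N → ℂ) * ExteriorAlgebra.ι ℂ (dx j)) =
      ExteriorAlgebra.ι ℂ u * ExteriorAlgebra.ι ℂ v := by
    intro u v
    conv_rhs => rw [eq_sum_dx u, eq_sum_dx v]
    simp only [map_sum, map_smul, Finset.sum_mul_sum, smul_mul_smul_comm]
  simp only [twoForm, wedgeMatrix, Matrix.sub_apply, vecMulVec_apply, sub_smul, Finset.sum_sub_distrib]
  rw [h, h, ι_mul_ι_anticomm v u, sub_neg_eq_add, ← two_smul ℂ, smul_smul,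
    inv_mul_cancel₀ two_ne_zero, one_smul]

lemma ι_mul_ι_mem_two (u v : Idx N → ℂ) :
    ExteriorAlgebra.ι ℂ u * ExteriorAlgebra.ι ℂ v ∈ ⋀[ℂ]^2 (Idx N → ℂ) :=
  mul_mem_exteriorPower (ι_mem_exteriorPower_one u) (ι_mem_exteriorPower_one v)

lemma add_pow_succ_of_sq_eq_zero {A : Type*} [Ring A] {x y : A} (h : Commute x y)
    (hx : x * x = 0) (n : ℕ) : (x + y) ^ (n + 1) = y ^ (n + 1) + (n + 1) • (x * y ^ n) := by
  induction n with
  | zero => simp [add_comm]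
  | succ n ih =>
    rw [pow_succ', ih, add_mul, mul_add, mul_add, mul_smul_comm, ← mul_assoc x x, hx, zero_mul,
      smul_zero, add_zero, ← pow_succ', mul_smul_comm, ← mul_assoc y x, ← h.eq, mul_assoc,
      ← pow_succ', succ_nsmul _ (n + 1)]
    abel

lemma ι_mul_ι_sq (u v : Idx N → ℂ) : ExteriorAlgebra.ι ℂ u * ExteriorAlgebra.ι ℂ v *
    (ExteriorAlgebra.ι ℂ u * ExteriorAlgebra.ι ℂ v) = 0 := by
  rw [mul_assoc, (commute_of_mem_two (ι_mul_ι_mem_two u v) (ExteriorAlgebra.ι ℂ v)).symm.eq,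
    mul_assoc, ExteriorAlgebra.ι_sq_zero, mul_zero, mul_zero]

lemma sum_pow_eq_zero {m : ℕ} (u v : Fin m → Idx N → ℂ) :
    (∑ a, ExteriorAlgebra.ι ℂ (u a) * ExteriorAlgebra.ι ℂ (v a)) ^ (m + 1) = 0 := by
  induction m with
  | zero => simp
  | succ m ih =>
    rw [Fin.sum_univ_succ, add_pow_succ_of_sq_eq_zero
      (commute_of_mem_two (ι_mul_ι_mem_two _ _) _) (ι_mul_ι_sq _ _), pow_succ, ih, zero_mul,
      mul_zero, smul_zero, add_zero]

lemma sum_pow_eq {m : ℕ} (u v : Fin m → Idx N → ℂ) :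
    (∑ a, ExteriorAlgebra.ι ℂ (u a) * ExteriorAlgebra.ι ℂ (v a)) ^ m =
      (m.factorial : ℂ) •
        (List.ofFn fun a => ExteriorAlgebra.ι ℂ (u a) * ExteriorAlgebra.ι ℂ (v a)).prod := by
  induction m with
  | zero => simp
  | succ m ih =>
    rw [Fin.sum_univ_succ, add_pow_succ_of_sq_eq_zero
      (commute_of_mem_two (ι_mul_ι_mem_two _ _) _) (ι_mul_ι_sq _ _), sum_pow_eq_zero, ih, zero_add,
      List.ofFn_succ, List.prod_cons, mul_smul_comm, ← Nat.cast_smul_eq_nsmul ℂ, smul_smul,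
      Nat.factorial_succ, Nat.cast_mul]

lemma contract_prod_pairs {m : ℕ} {f : Module.Dual ℂ (Idx N → ℂ)} {u v : Fin m → Idx N → ℂ}
    (hu : ∀ a, f (u a) = 0) (hv : ∀ a, f (v a) = 0) :
    contract f (List.ofFn fun a => ExteriorAlgebra.ι ℂ (u a) * ExteriorAlgebra.ι ℂ (v a)).prod
      = 0 := by
  induction m with
  | zero => simp
  | succ m ih =>
    rw [List.ofFn_succ, List.prod_cons, mul_assoc, contract_ι_mul, contract_ι_mul, hu, hv,
      ih (fun a => hu a.succ) fun a => hv a.succ]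
    simp

/-- Contracting with the functionals dual to the first pair strips it off, since they vanish on all
later covectors. -/
lemma prod_pairs_ne_zero {m : ℕ} {u v : Fin m → Idx N → ℂ}
    (h : LinearIndependent ℂ (Sum.elim u v)) :
    (List.ofFn fun a => ExteriorAlgebra.ι ℂ (u a) * ExteriorAlgebra.ι ℂ (v a)).prod ≠ 0 := by
  induction m with
  | zero => simp
  | succ m ih =>
    have h' : LinearIndependent ℂ (Sum.elim (fun a : Fin m => u a.succ) fun a : Fin m => v a.succ) := by
      have := h.comp (Sum.map Fin.succ Fin.succ)
        ((Fin.succ_injective m).sumMap (Fin.succ_injective m))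
      convert this using 1
      funext i
      rcases i with a | a <;> rfl
    obtain ⟨f, hf⟩ := exists_dual_of_linearIndependent h
    have hfu : ∀ i a, f i (u a) = Finsupp.single (Sum.inl a) (1 : ℂ) i := fun i a =>
      hf i (Sum.inl a)
    have hfv : ∀ i a, f i (v a) = Finsupp.single (Sum.inr a) (1 : ℂ) i := fun i a =>
      hf i (Sum.inr a)
    rw [List.ofFn_succ, List.prod_cons, mul_assoc]
    set ω := (List.ofFn fun a : Fin m =>
      ExteriorAlgebra.ι ℂ (u a.succ) * ExteriorAlgebra.ι ℂ (v a.succ)).prod with hω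
    intro h0
    apply ih h'
    rw [← hω]
    have h1 := ι_mul_contract (f := f (Sum.inl 0)) h0
    rw [contract_ι_mul, hω, contract_prod_pairs (fun a => by simp [hfu])
      (fun a => by simp [hfv]), ← hω, hfu, hfv] at h1
    simp only [ne_eq, reduceCtorEq, not_false_eq_true, Finsupp.single_eq_of_ne, zero_smul, mul_zero,
      sub_zero, Finsupp.single_eq_same, one_smul] at h1
    have h2 := ι_mul_contract (f := f (Sum.inr 0)) h1.symm
    rw [hω, contract_prod_pairs (fun a => by simp [hfu])
      (fun a => by simp [hfv]), ← hω, hfv] at h2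
    simpa using h2.symm

lemma even_rank {M : Matrix (Idx N) (Idx N) ℂ} (hM : Mᵀ = -M) : Even M.rank := by
  obtain ⟨m, u, v, rfl, hli⟩ := exists_eq_sum_wedgeMatrix M hM
  rw [rank_sum_wedgeMatrix hli]
  exact even_two_mul m

/-- A normal form with `m` pairs has rank `2m`; its `m`-th power is `m!` times a nonzero product of
all pairs, and its next power vanishes because each pair squares to zero. -/
lemma twoForm_pow_eq_zero_iff {M : Matrix (Idx N) (Idx N) ℂ} (hM : Mᵀ = -M) (q : ℕ) :
    twoForm M ^ q = 0 ↔ M.rank < 2 * q := by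
  obtain ⟨m, u, v, rfl, hli⟩ := exists_eq_sum_wedgeMatrix M hM
  rw [rank_sum_wedgeMatrix hli, twoForm_sum]
  simp_rw [twoForm_wedgeMatrix]
  constructor
  · intro h
    by_contra hq
    have h1 : (∑ a, ExteriorAlgebra.ι ℂ (u a) * ExteriorAlgebra.ι ℂ (v a)) ^ m = 0 :=
      pow_eq_zero_of_le (by omega) h
    rw [sum_pow_eq] at h1
    refine prod_pairs_ne_zero hli ((smul_eq_zero.mp h1).resolve_left ?_)
    exact_mod_cast m.factorial_ne_zero
  · intro h
    exact pow_eq_zero_of_le (by omega) (sum_pow_eq_zero u v)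

lemma rank_lt_iff {M : Matrix (Idx N) (Idx N) ℂ} (hM : Mᵀ = -M) (k : ℕ) :
    M.rank < 2 * (k + 1) ↔ M.rank ≤ 2 * k := by
  obtain ⟨r, hr⟩ := even_rank hM
  omega

lemma isIsotropic_range {M : Matrix (Idx N) (Idx N) ℂ} (hM : Mᵀ = -M) (hM2 : M * M = 0) :
    IsIsotropic (LinearMap.range M.mulVecLin) := by
  rintro _ ⟨x, rfl⟩ _ ⟨y, rfl⟩
  rw [mulVecLin_apply, mulVecLin_apply, ← neg_eq_zero, ← dotProduct_mulVec_antisymm hM,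
    mulVec_mulVec, hM2, zero_mulVec, dotProduct_zero]

lemma rank_le_of_mul_self_eq_zero {M : Matrix (Idx N) (Idx N) ℂ} (hM : Mᵀ = -M)
    (hM2 : M * M = 0) : M.rank ≤ N :=
  (isIsotropic_range hM hM2).finrank_le

/-- At zero coefficient the relation says that every row of `M` annihilates `η`; by antisymmetry the
rows span the image of `M`. -/
lemma mesonSpinorRelation_zero_iff {M : Matrix (Idx N) (Idx N) ℂ} (hM : Mᵀ = -M) (η : Spinor N) :
    MesonSpinorRelation M 0 η ↔ LinearMap.range M.mulVecLin ≤ spinorAnn η := by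
  have h : ∀ i, ∑ j, M i j • (gamma j *ᵥ η) = gammaLin (M i) *ᵥ η := by
    intro i
    rw [gammaLin_apply, Matrix.sum_mulVec]
    simp_rw [smul_mulVec]
  have hrow : ∀ i, M *ᵥ dx i = -M i := by
    intro i
    ext j
    have := congrFun (congrFun hM i) j
    simp only [transpose_apply, Matrix.neg_apply] at this
    simp [dx, this]
  constructor
  · rintro hr _ ⟨x, rfl⟩
    rw [mulVecLin_apply, eq_sum_dx x, mulVec_sum]
    refine Submodule.sum_mem _ fun i _ => ?_
    rw [mulVec_smul, hrow]
    refine Submodule.smul_mem _ _ (Submodule.neg_mem _ ?_)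
    rw [mem_spinorAnn, ← h, hr i, zero_smul]
  · intro hr i
    rw [h, zero_smul, ← mem_spinorAnn, ← neg_mem_iff, ← hrow]
    exact hr ⟨dx i, rfl⟩

/-! ### Existence of pure spinors -/

lemma finrank_sup_span_singleton_le (W : Submodule ℂ (Idx N → ℂ)) (v : Idx N → ℂ) :
    Module.finrank ℂ ↥(W ⊔ Submodule.span ℂ {v}) ≤ Module.finrank ℂ W + 1 :=
  (Submodule.finrank_add_le_finrank_add_finrank W _).trans
    (Nat.add_le_add_left ((finrank_span_le_card {v}).trans (by simp)) _)

lemma lt_finrank_sup_span_singleton {W : Submodule ℂ (Idx N → ℂ)} {v : Idx N → ℂ} (hv : v ∉ W) :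
    Module.finrank ℂ W < Module.finrank ℂ ↥(W ⊔ Submodule.span ℂ {v}) := by
  refine Submodule.finrank_lt_finrank_of_lt (lt_of_le_of_ne le_sup_left fun h => hv ?_)
  rw [h]
  exact Submodule.mem_sup_right (Submodule.mem_span_singleton_self v)

lemma exists_mem_notMem_of_finrank_lt {W W' : Submodule ℂ (Idx N → ℂ)}
    (h : Module.finrank ℂ W < Module.finrank ℂ W') : ∃ v ∈ W', v ∉ W := by
  by_contra! hcon
  exact absurd (Submodule.finrank_mono (show W' ≤ W from hcon)) (by omega)

lemma IsIsotropic.sup_span_singleton {W : Submodule ℂ (Idx N → ℂ)} (hW : IsIsotropic W)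
    {v : Idx N → ℂ} (hv : v ∈ (dotForm N).orthogonal W) (hvv : v ⬝ᵥ v = 0) :
    IsIsotropic (W ⊔ Submodule.span ℂ {v}) := by
  intro x hx y hy
  obtain ⟨x₁, hx₁, x₂, hx₂, rfl⟩ := Submodule.mem_sup.mp hx
  obtain ⟨y₁, hy₁, y₂, hy₂, rfl⟩ := Submodule.mem_sup.mp hy
  obtain ⟨a, rfl⟩ := Submodule.mem_span_singleton.mp hx₂
  obtain ⟨b, rfl⟩ := Submodule.mem_span_singleton.mp hy₂
  rw [mem_orthogonal] at hv
  simp [hW x₁ hx₁ y₁ hy₁, hv x₁ hx₁, dotProduct_comm v, hv y₁ hy₁, hvv]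

/-- The dimension of the orthogonal complement exceeds that of `W` by at least two. This leaves room
for a pencil `b + t a` outside `W`, on which the norm is a quadratic polynomial in `t` with a
complex root. -/
lemma IsIsotropic.exists_isotropic_vector {W : Submodule ℂ (Idx N → ℂ)}
    (hN : Module.finrank ℂ W < N) :
    ∃ v ∈ (dotForm N).orthogonal W, v ∉ W ∧ v ⬝ᵥ v = 0 := by
  have hd := finrank_orthogonal_add W
  obtain ⟨a, ha, haW⟩ := exists_mem_notMem_of_finrank_lt
    (show Module.finrank ℂ W < Module.finrank ℂ ((dotForm N).orthogonal W) by omega)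
  by_cases haa : a ⬝ᵥ a = 0
  · exact ⟨a, ha, haW, haa⟩
  have hs := finrank_sup_span_singleton_le W a
  obtain ⟨b, hb, hbW⟩ := exists_mem_notMem_of_finrank_lt
    (show Module.finrank ℂ ↥(W ⊔ Submodule.span ℂ {a}) <
      Module.finrank ℂ ((dotForm N).orthogonal W) by omega)
  obtain ⟨t, ht⟩ := exists_quadratic_eq_zero haa (b := 2 * (a ⬝ᵥ b)) (c := b ⬝ᵥ b)
    (by obtain ⟨s, hs⟩ := IsAlgClosed.exists_eq_mul_self
          (discrim (a ⬝ᵥ a) (2 * (a ⬝ᵥ b)) (b ⬝ᵥ b))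
        exact ⟨s, hs⟩)
  refine ⟨b + t • a, Submodule.add_mem _ hb (Submodule.smul_mem _ _ ha), fun h => hbW ?_, ?_⟩
  · have : b = (b + t • a) + (-t) • a := by simp
    rw [this]
    exact Submodule.add_mem _ (Submodule.mem_sup_left h)
      (Submodule.mem_sup_right (Submodule.smul_mem _ _ (Submodule.mem_span_singleton_self a)))
  · simp only [add_dotProduct, dotProduct_add, smul_dotProduct, dotProduct_smul, smul_eq_mul,
      dotProduct_comm b a]
    linear_combination ht

/-- Every isotropic subspace is contained in isotropic subspaces of all larger dimensions up
to `N`. -/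
lemma IsIsotropic.exists_le_finrank_eq {W : Submodule ℂ (Idx N → ℂ)} (hW : IsIsotropic W) {n : ℕ}
    (h : Module.finrank ℂ W ≤ n) (hn : n ≤ N) :
    ∃ L, W ≤ L ∧ IsIsotropic L ∧ Module.finrank ℂ L = n := by
  induction n, h using Nat.le_induction with
  | base => exact ⟨W, le_rfl, hW, rfl⟩
  | succ n _ ih =>
    obtain ⟨L, hWL, hL, rfl⟩ := ih (by omega)
    obtain ⟨v, hv, hvL, hvv⟩ := IsIsotropic.exists_isotropic_vector (W := L) (by omega)
    refine ⟨L ⊔ Submodule.span ℂ {v}, hWL.trans le_sup_left, hL.sup_span_singleton hv hvv, ?_⟩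
    have h1 := lt_finrank_sup_span_singleton hvL
    have h2 := finrank_sup_span_singleton_le L v
    omega

lemma chirality_mul_gammaLin (v : Idx N → ℂ) :
    chirality N * gammaLin v = -(gammaLin v * chirality N) := by
  rw [gammaLin_apply, Finset.mul_sum, Finset.sum_mul, ← Finset.sum_neg_distrib]
  refine Finset.sum_congr rfl fun i _ => ?_
  rw [mul_smul_comm, chirality_mul_gamma, smul_neg, smul_mul_assoc]

lemma chirality_mulVec_gammaLin {η : Spinor N} {ε : ℂ} (h : chirality N *ᵥ η = ε • η)
    (v : Idx N → ℂ) : chirality N *ᵥ (gammaLin v *ᵥ η) = (-ε) • (gammaLin v *ᵥ η) := by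
  rw [mulVec_mulVec, chirality_mul_gammaLin, neg_mulVec, ← mulVec_mulVec, h, mulVec_smul, neg_smul]

lemma gammaLin_mulVec_mem_spinorAnn {η : Spinor N} {v w : Idx N → ℂ} (hw : w ∈ spinorAnn η)
    (h : w ⬝ᵥ v = 0) : w ∈ spinorAnn (gammaLin v *ᵥ η) := by
  rw [mem_spinorAnn] at hw ⊢
  have := congrArg (· *ᵥ η) (gammaLin_mul_add w v)
  simpa [add_mulVec, ← mulVec_mulVec, hw, h] using this

lemma mem_spinorAnn_gammaLin_self (η : Spinor N) {v : Idx N → ℂ} (h : v ⬝ᵥ v = 0) :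
    v ∈ spinorAnn (gammaLin v *ᵥ η) := by
  rw [mem_spinorAnn, mulVec_mulVec, gammaLin_mul_self, h, zero_smul, zero_mulVec]

lemma exists_chiral_spinor : ∃ η : Spinor N, η ≠ 0 ∧ chirality N *ᵥ η = η := by
  -- The state `|+…+⟩`, since the label `0` stands for `+`.
  refine ⟨Pi.single 0 1, by simp, ?_⟩
  rw [mulVec_single_one]
  ext s
  simp only [col_apply, chirality, tensor, of_apply, Pi.single_apply]
  by_cases hs : s = 0
  · simp [hs, pauli3]
  · rw [if_neg hs]
    obtain ⟨a, ha⟩ := Function.ne_iff.mp hs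
    have ha1 : s a = 1 := Fin.eq_one_of_ne_zero _ ha
    exact Finset.prod_eq_zero (Finset.mem_univ a) (by rw [ha1]; simp [pauli3])

/-- If `v` does not yet kill `η`, replace `η` by `γ_v η`. Then `v` kills it because `v·v = 0`, the
earlier annihilators survive by orthogonality, and the chirality flips. -/
lemma exists_spinor_of_list (l : List (Idx N → ℂ)) (h : ∀ v ∈ l, ∀ w ∈ l, v ⬝ᵥ w = 0) :
    ∃ η : Spinor N, η ≠ 0 ∧ (chirality N *ᵥ η = (1 : ℂ) • η ∨ chirality N *ᵥ η = (-1 : ℂ) • η) ∧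
      ∀ v ∈ l, v ∈ spinorAnn η := by
  induction l with
  | nil =>
    obtain ⟨η, h0, h1⟩ := exists_chiral_spinor (N := N)
    exact ⟨η, h0, Or.inl (by rw [h1, one_smul]), by simp⟩
  | cons v l ih =>
    obtain ⟨η, h0, hc, hl⟩ := ih fun x hx y hy => h x (by simp [hx]) y (by simp [hy])
    by_cases hv : gammaLin v *ᵥ η = 0
    · exact ⟨η, h0, hc, List.forall_mem_cons.mpr ⟨mem_spinorAnn.mpr hv, hl⟩⟩
    · refine ⟨gammaLin v *ᵥ η, hv, ?_, List.forall_mem_cons.mpr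
        ⟨mem_spinorAnn_gammaLin_self η (h v (by simp) v (by simp)), fun w hw =>
          gammaLin_mulVec_mem_spinorAnn (hl w hw) (h w (by simp [hw]) v (by simp))⟩⟩
      rcases hc with hc | hc
      · exact Or.inr (chirality_mulVec_gammaLin hc v)
      · left
        rw [chirality_mulVec_gammaLin hc v, neg_neg]

/-- Every isotropic subspace annihilates a nonzero chiral spinor. -/
lemma IsIsotropic.exists_spinor {W : Submodule ℂ (Idx N → ℂ)} (hW : IsIsotropic W) :
    ∃ η : Spinor N, η ≠ 0 ∧ (chirality N *ᵥ η = (1 : ℂ) • η ∨ chirality N *ᵥ η = (-1 : ℂ) • η) ∧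
      W ≤ spinorAnn η := by
  obtain ⟨s, rfl⟩ := IsNoetherian.noetherian W
  obtain ⟨η, h0, hc, hl⟩ := exists_spinor_of_list s.toList fun v hv w hw =>
    hW v (Submodule.subset_span (by simpa using hv)) w (Submodule.subset_span (by simpa using hw))
  exact ⟨η, h0, hc, Submodule.span_le.mpr fun v hv => hl v (by simpa using hv)⟩

/-- An isotropic subspace that is not maximal annihilates pure spinors of both chiralities. -/
lemma IsIsotropic.exists_pure_spinor {W : Submodule ℂ (Idx N → ℂ)} (hW : IsIsotropic W)
    (hN : Module.finrank ℂ W < N) {ε : ℂ} (hε : ε = 1 ∨ ε = -1) :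
    ∃ η : Spinor N, η ≠ 0 ∧ chirality N *ᵥ η = ε • η ∧ W ≤ spinorAnn η ∧ PurityRelation η := by
  obtain ⟨H, hWH, hH, hHd⟩ := hW.exists_le_finrank_eq (n := N - 1) (by omega) (by omega)
  obtain ⟨L, hHL, hL, hLd⟩ := hH.exists_le_finrank_eq (n := N) (by omega) le_rfl
  obtain ⟨η, h0, hc, hLη⟩ := hL.exists_spinor
  have hpure : PurityRelation η :=
    purityRelation_of_le_finrank h0 (hLd.ge.trans (Submodule.finrank_mono hLη))
  obtain ⟨ε', hε', hc'⟩ : ∃ ε' : ℂ, (ε' = 1 ∨ ε' = -1) ∧ chirality N *ᵥ η = ε' • η := by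
    rcases hc with hc | hc
    exacts [⟨1, Or.inl rfl, hc⟩, ⟨-1, Or.inr rfl, hc⟩]
  by_cases heq : ε = ε'
  · exact ⟨η, h0, heq ▸ hc', hWH.trans (hHL.trans hLη), hpure⟩
  have hneg : ε = -ε' := by
    rcases hε with rfl | rfl <;> rcases hε' with rfl | rfl <;> simp_all
  have hd := finrank_orthogonal_add H
  -- The wrong chirality is flipped by a `γ_v'` that keeps `H` in the annihilator. As `H` has
  -- dimension `N - 1`, its orthogonal complement has dimension `N + 1` and leaves `L`.
  obtain ⟨v, hv, hvL⟩ := exists_mem_notMem_of_finrank_lt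
    (show Module.finrank ℂ L < Module.finrank ℂ ((dotForm N).orthogonal H) by omega)
  rw [← hL.orthogonal_eq hLd.ge, mem_orthogonal] at hvL
  push Not at hvL
  obtain ⟨w, hw, hwv⟩ := hvL
  -- The multiple of the isotropic `w` makes `v'` isotropic without changing its pairing with `w`.
  set v' := v - ((v ⬝ᵥ v) / (2 * (w ⬝ᵥ v))) • w with hv'
  have hww := hL w hw w hw
  have hv'w : w ⬝ᵥ v' = w ⬝ᵥ v := by
    rw [hv', dotProduct_sub, dotProduct_smul, hww, smul_zero, sub_zero]
  have hv'v' : v' ⬝ᵥ v' = 0 := by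
    simp only [hv', dotProduct_sub, sub_dotProduct, dotProduct_smul, smul_dotProduct, hww,
      smul_eq_mul, dotProduct_comm v w]
    field_simp
    ring
  have hv'H : v' ∈ (dotForm N).orthogonal H := Submodule.sub_mem _ hv
    (Submodule.smul_mem _ _ fun x hx => hL x (hHL hx) w hw)
  have hv'0 : gammaLin v' *ᵥ η ≠ 0 := by
    intro h
    refine hwv ?_
    rw [← hv'w]
    exact isIsotropic_spinorAnn h0 w (hLη hw) v' (mem_spinorAnn.mpr h)
  have hHη : H ≤ spinorAnn (gammaLin v' *ᵥ η) := fun x hx =>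
    gammaLin_mulVec_mem_spinorAnn (hLη (hHL hx)) (mem_orthogonal.mp hv'H x hx)
  refine ⟨gammaLin v' *ᵥ η, hv'0, ?_, hWH.trans hHη, purityRelation_of_le_finrank hv'0 ?_⟩
  · rw [chirality_mulVec_gammaLin hc', hneg]
  · have h1 : v' ∉ H := fun h => hwv (hv'w ▸ hL w hw v' (hHL h))
    have h2 := lt_finrank_sup_span_singleton h1
    have h3 : H ⊔ Submodule.span ℂ {v'} ≤ spinorAnn (gammaLin v' *ᵥ η) :=
      sup_le hHη ((Submodule.span_singleton_le_iff_mem _ _).mpr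
        (mem_spinorAnn_gammaLin_self η hv'v'))
    have h4 := Submodule.finrank_mono h3
    omega

/-! ### The chirality matrix in rotated frames -/

/-- The coordinates in the order `x^1, y^1, x^2, y^2, …`. -/
def coordEquiv (N : ℕ) : Fin (N * 2) ≃ Idx N :=
  finProdFinEquiv.symm.trans <| (Equiv.prodComm _ _).trans <|
    (finTwoEquiv.prodCongr (Equiv.refl _)).trans (Equiv.boolProdEquivSum _)

lemma prod_ofFn_coordEquiv {A : Type*} [Monoid A] (f : Idx N → A) :
    (List.ofFn fun k => f (coordEquiv N k)).prod =
      ((List.finRange N).map fun a => f (Sum.inl a) * f (Sum.inr a)).prod := by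
  have h : ∀ (a : Fin N) (j : Fin 2) (hlt : a.val * 2 + j.val < N * 2),
      coordEquiv N ⟨a.val * 2 + j.val, hlt⟩ = if j = 0 then Sum.inl a else Sum.inr a := by
    intro a j hlt
    have : finProdFinEquiv.symm (⟨a.val * 2 + j.val, hlt⟩ : Fin (N * 2)) = (a, j) := by
      rw [Equiv.symm_apply_eq]
      ext
      simp [finProdFinEquiv, mul_comm, add_comm]
    simp only [coordEquiv, Equiv.trans_apply, this]
    fin_cases j <;> rfl
  rw [List.ofFn_mul, List.prod_flatten, List.map_ofFn, List.ofFn_eq_map]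
  congr 1
  refine List.map_congr_left fun a _ => ?_
  simp [h]

lemma tensor_map_prod (A : Matrix (Fin 2) (Fin 2) ℂ) {l : List (Fin N)} (hl : l.Nodup) :
    (l.map fun a => tensor fun b => if b = a then A else 1).prod =
      tensor fun b => if b ∈ l then A else 1 := by
  induction l with
  | nil => simp [tensor_one]
  | cons a l ih =>
    rw [List.nodup_cons] at hl
    rw [List.map_cons, List.prod_cons, ih hl.2, tensor_mul]
    congr 1
    funext b
    by_cases hb : b = a
    · subst hb; simp [hl.1]
    · simp [hb]

lemma gamma_inl_mul_gamma_inr (a : Fin N) :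
    (-Complex.I) • (gamma (Sum.inl a) * gamma (Sum.inr a)) =
      tensor fun b => if b = a then pauli3 else 1 := by
  have hc : -Complex.I = ∏ b : Fin N, if b = a then -Complex.I else 1 := by simp
  rw [gamma_eq, gamma_eq, tensor_mul, hc, ← tensor_smul]
  congr 1
  funext b
  by_cases hb : b = a
  · subst hb
    simp [site, pauliFactor, pauli1_mul_pauli2, smul_smul]
  · simp only [site, Sum.elim_inl, Sum.elim_inr, id, hb, if_false, one_smul]
    split_ifs
    exacts [pauli3_mul_pauli3, one_mul 1]

lemma prod_map_smul {ι A : Type*} [Ring A] [Algebra ℂ A] (c : ℂ) (f : ι → A) (l : List ι) :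
    (l.map fun a => c • f a).prod = c ^ l.length • (l.map f).prod := by
  induction l with
  | nil => simp
  | cons a l ih =>
    rw [List.map_cons, List.prod_cons, ih, List.map_cons, List.prod_cons, smul_mul_smul_comm,
      List.length_cons, pow_succ']

lemma prod_gamma_eq_chirality :
    (-Complex.I) ^ N • (List.ofFn fun k => gamma (coordEquiv N k)).prod = chirality N := by
  rw [prod_ofFn_coordEquiv]
  have h := prod_map_smul (-Complex.I) (fun a : Fin N => gamma (Sum.inl a) * gamma (Sum.inr a))
    (List.finRange N)
  rw [List.length_finRange] at h
  rw [← h]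
  simp_rw [gamma_inl_mul_gamma_inr]
  rw [tensor_map_prod _ (List.nodup_finRange N)]
  simp [chirality]

lemma cliffordMap_ιMulti {q : ℕ} (v : Fin q → Idx N → ℂ) (h : ∀ i j, i ≠ j → v i ⬝ᵥ v j = 0) :
    cliffordMap (ExteriorAlgebra.ιMulti ℂ q v) = (List.ofFn fun k => gammaLin (v k)).prod := by
  have := cliffordMap_prod (List.ofFn v) (List.pairwise_ofFn.mpr fun i j hij => h i j hij.ne)
  rw [List.map_ofFn, List.map_ofFn] at this
  rw [ExteriorAlgebra.ιMulti_apply]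
  exact this

lemma mulVec_dotProduct_mulVec {g : Matrix (Idx N) (Idx N) ℂ} (hg : g * gᵀ = 1)
    (v w : Idx N → ℂ) : (g *ᵥ v) ⬝ᵥ (g *ᵥ w) = v ⬝ᵥ w := by
  rw [dotProduct_mulVec, ← mulVec_transpose, mulVec_mulVec, mul_eq_one_comm.mp hg, one_mulVec]

/-- The product of the gamma matrices in a rotated frame. -/
lemma prod_gammaLin_mulVec {g : Matrix (Idx N) (Idx N) ℂ} (hg : g * gᵀ = 1) :
    (List.ofFn fun k => gammaLin (g *ᵥ dx (coordEquiv N k))).prod =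
      g.det • (List.ofFn fun k => gamma (coordEquiv N k)).prod := by
  let e := (Pi.basisFun ℂ (Idx N)).reindex (coordEquiv N).symm
  have he : ∀ k, e k = dx (coordEquiv N k) := fun k => by simp [e, dx]
  have horth : ∀ i j, i ≠ j →
      (dx (coordEquiv N i) : Idx N → ℂ) ⬝ᵥ dx (coordEquiv N j) = 0 := fun i j hij => by
    rw [dx_dotProduct_dx, if_neg fun h => hij ((coordEquiv N).injective h)]
  have h1 := cliffordMap_ιMulti (fun k => g *ᵥ dx (coordEquiv N k)) fun i j hij => by
    rw [mulVec_dotProduct_mulVec hg, horth i j hij]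
  have h2 := cliffordMap_ιMulti (fun k => dx (coordEquiv N k)) horth
  simp_rw [gammaLin_dx] at h2
  rw [← h1, ← h2]
  ext s t
  -- Each matrix entry of the Clifford image is an alternating form in `2N` covectors, hence a
  -- multiple of the determinant.
  let φ : Polyform N →ₗ[ℂ] ℂ := Matrix.entryLinearMap ℂ ℂ s t ∘ₗ cliffordMap
  have h3 := AlternatingMap.eq_smul_basis_det e
    (φ.compAlternatingMap (ExteriorAlgebra.ιMulti ℂ (N * 2)))
  have h4 := congrArg (fun f => f (Matrix.toLin' g ∘ e)) h3
  simp only [AlternatingMap.smul_apply, Module.Basis.det_comp, Module.Basis.det_self, mul_one,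
    LinearMap.det_toLin', LinearMap.compAlternatingMap_apply, smul_eq_mul] at h4
  have h5 : (Matrix.toLin' g ∘ e) = fun k => g *ᵥ dx (coordEquiv N k) := by
    funext k
    simp [he]
  have h6 : (e : Fin (N * 2) → Idx N → ℂ) = fun k => dx (coordEquiv N k) := funext he
  rw [h5, h6] at h4
  exact h4.trans (mul_comm _ _)

lemma prod_mulVec_of_eigen {ι : Type*} (X : ι → Matrix (SpinIdx N) (SpinIdx N) ℂ) (s : ι → ℂ)
    {η : Spinor N} (h : ∀ a, X a *ᵥ η = s a • η) (l : List ι) :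
    (l.map X).prod *ᵥ η = (l.map s).prod • η := by
  induction l with
  | nil => simp
  | cons a l ih =>
    rw [List.map_cons, List.prod_cons, ← mulVec_mulVec, ih, mulVec_smul, h, List.map_cons,
      List.prod_cons, smul_smul, mul_comm]

lemma dx_mulVec_eq (g : Matrix (Idx N) (Idx N) ℂ) (b : Bool) (a : Fin N) :
    g *ᵥ dz b a = g *ᵥ dx (Sum.inl a) +
      (if b then -Complex.I else Complex.I) • (g *ᵥ dx (Sum.inr a)) := by
  rw [dz, mulVec_add, mulVec_smul]

/-- The chirality of a spinor annihilated by a rotated frame of complex covectors. -/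
lemma chirality_mulVec_of_annihilated {g : Matrix (Idx N) (Idx N) ℂ} (hg : g * gᵀ = 1)
    (hdet : g.det = 1) (b : Fin N → Bool) {η : Spinor N}
    (h : ∀ a, g *ᵥ dz (b a) a ∈ spinorAnn η) :
    chirality N *ᵥ η = (∏ a, if b a then (-1 : ℂ) else 1) • η := by
  -- Annihilation by the rotated `dx + i dy` or `dx - i dy` makes `-i γ_x γ_y` act as `+1` or `-1`.
  -- As `det g = 1`, the product of these factors is the chirality matrix.
  have hfac : ∀ a, (-Complex.I) • (gammaLin (g *ᵥ dx (Sum.inl a)) *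
      gammaLin (g *ᵥ dx (Sum.inr a))) *ᵥ η = (if b a then (-1 : ℂ) else 1) • η := by
    intro a
    have h1 := mem_spinorAnn.mp (h a)
    rw [dx_mulVec_eq, map_add, map_smul, add_mulVec, smul_mulVec] at h1
    have h2 : gammaLin (g *ᵥ dx (Sum.inl a)) *ᵥ (gammaLin (g *ᵥ dx (Sum.inl a)) *ᵥ η) = η := by
      rw [mulVec_mulVec, gammaLin_mul_self, mulVec_dotProduct_mulVec hg, dx_dotProduct_dx,
        if_pos rfl, one_smul, one_mulVec]
    rw [← mulVec_mulVec]
    have h3 := congrArg (fun ξ => gammaLin (g *ᵥ dx (Sum.inl a)) *ᵥ ξ) h1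
    simp only [mulVec_add, h2, mulVec_smul, mulVec_zero] at h3
    have h4 := eq_neg_of_add_eq_zero_right h3
    cases hb : b a
    · simp only [hb, Bool.false_eq_true, if_false] at h4 ⊢
      rw [neg_smul, h4, neg_neg, one_smul]
    · simp only [hb, if_true] at h4 ⊢
      rw [h4, neg_one_smul]
  have h1 := prod_gammaLin_mulVec hg
  rw [hdet, one_smul] at h1
  rw [← prod_gamma_eq_chirality, ← h1, prod_ofFn_coordEquiv fun i => gammaLin (g *ᵥ dx i)]
  have h2 := prod_map_smul (-Complex.I) (fun a : Fin N => gammaLin (g *ᵥ dx (Sum.inl a)) *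
    gammaLin (g *ᵥ dx (Sum.inr a))) (List.finRange N)
  rw [List.length_finRange] at h2
  rw [← h2, prod_mulVec_of_eigen _ _ (fun a => by rw [smul_mulVec]; exact hfac a)]
  rw [← List.ofFn_eq_map, List.prod_ofFn]

/-! ### The very even orbits -/

/-- The covectors `dz^1, …, dz^N`, with the last one replaced by `dz̄^N` if `barred` is true. -/
def frame (N : ℕ) (barred : Bool) (a : Fin N) : Idx N → ℂ :=
  dz (barred && decide (a.val + 1 = N)) a

/-- The matrix of the two-form `w_1 ∧ w_2 + w_3 ∧ w_4 + …`. -/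
def pairMatrix (w : Fin N → Idx N → ℂ) : Matrix (Idx N) (Idx N) ℂ :=
  ∑ m : Fin (N / 2), wedgeMatrix (w ⟨2 * m.val, by omega⟩) (w ⟨2 * m.val + 1, by omega⟩)

lemma veryEvenRep_eq (hN : Even N) (barred : Bool) :
    veryEvenRep N barred = pairMatrix (frame N barred) := by
  refine Finset.sum_congr rfl fun m _ => ?_
  -- The last covector is the second member of its pair, so the first members are never barred.
  have h1 : ¬ (2 * m.val + 1 = N) := by
    rintro h
    rw [← h] at hN
    exact Nat.not_even_two_mul_add_one _ hN
  simp [frame, h1]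

lemma mul_wedgeMatrix_mul (g : Matrix (Idx N) (Idx N) ℂ) (u v : Idx N → ℂ) :
    g * wedgeMatrix u v * gᵀ = wedgeMatrix (g *ᵥ u) (g *ᵥ v) := by
  simp only [wedgeMatrix, Matrix.mul_sub, Matrix.sub_mul, mul_vecMulVec, vecMulVec_mul,
    vecMul_transpose]

lemma mul_pairMatrix_mul (g : Matrix (Idx N) (Idx N) ℂ) (w : Fin N → Idx N → ℂ) :
    g * pairMatrix w * gᵀ = pairMatrix fun a => g *ᵥ w a := by
  simp only [pairMatrix, Finset.mul_sum, Finset.sum_mul, mul_wedgeMatrix_mul]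

lemma mem_veryEvenOrbit_iff (hN : Even N) (barred : Bool) (M : Matrix (Idx N) (Idx N) ℂ) :
    M ∈ veryEvenOrbit N barred ↔ ∃ g : Matrix (Idx N) (Idx N) ℂ, g * gᵀ = 1 ∧ g.det = 1 ∧
      M = pairMatrix fun a => g *ᵥ frame N barred a := by
  simp only [veryEvenOrbit, Set.mem_ofPred_eq, veryEvenRep_eq hN, mul_pairMatrix_mul]

/-- Evenness of `N` puts every index into some pair, so the image contains the whole frame. -/
lemma mem_range_pairMatrix (hN : Even N) {w : Fin N → Idx N → ℂ} (hw : LinearIndependent ℂ w)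
    (a : Fin N) : w a ∈ LinearMap.range (pairMatrix w).mulVecLin := by
  let σ : Fin (N / 2) ⊕ Fin (N / 2) → Fin N :=
    Sum.elim (fun m => ⟨2 * m.val, by omega⟩) fun m => ⟨2 * m.val + 1, by omega⟩
  have hσ : Function.Injective σ := by
    rintro (m | m) (m' | m') h <;> simp [σ, Fin.ext_iff] at h ⊢ <;> omega
  have hli : LinearIndependent ℂ (Sum.elim
      (fun m : Fin (N / 2) => w ⟨2 * m.val, by omega⟩)
      fun m : Fin (N / 2) => w ⟨2 * m.val + 1, by omega⟩) := by
    convert hw.comp σ hσ using 1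
    funext i
    rcases i with m | m <;> rfl
  rw [pairMatrix, range_sum_wedgeMatrix hli]
  apply Submodule.subset_span
  obtain ⟨r, hr⟩ := hN
  rcases Nat.even_or_odd' a.val with ⟨m, hm | hm⟩
  · refine ⟨Sum.inl ⟨m, by omega⟩, ?_⟩
    simp only [Sum.elim_inl]
    congr 1
    exact Fin.ext hm.symm
  · refine ⟨Sum.inr ⟨m, by omega⟩, ?_⟩
    simp only [Sum.elim_inr]
    congr 1
    exact Fin.ext hm.symm

lemma dz_dotProduct (b b' : Bool) (a a' : Fin N) :
    dz b a ⬝ᵥ dz b' a' = if a = a' ∧ b ≠ b' then 2 else 0 := by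
  simp only [dz, dotProduct_add, add_dotProduct, smul_dotProduct, dotProduct_smul,
    dx_dotProduct_dx, Sum.inl.injEq, Sum.inr.injEq, reduceCtorEq, if_false, smul_eq_mul]
  by_cases h : a = a'
  · subst h
    cases b <;> cases b' <;> simp <;> norm_num
  · simp [h]

lemma linearIndependent_of_dotProduct {w p : Fin N → Idx N → ℂ}
    (h : ∀ a b, p a ⬝ᵥ w b = if a = b then 2 else 0) : LinearIndependent ℂ w := by
  rw [Fintype.linearIndependent_iff]
  intro g hg a
  have := congrArg (p a ⬝ᵥ ·) hg
  simpa [dotProduct_sum, h] using this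

/-- The image of `M` contains the whole rotated frame, and the single barred covector contributes
the only minus sign. This invariant separates the two orbits. -/
lemma chirality_of_mem_veryEvenOrbit (h0 : 0 < N) (hN : Even N) {barred : Bool}
    {M : Matrix (Idx N) (Idx N) ℂ} (hM : M ∈ veryEvenOrbit N barred) {η : Spinor N}
    (hη : LinearMap.range M.mulVecLin ≤ spinorAnn η) :
    chirality N *ᵥ η = (if barred then (-1 : ℂ) else 1) • η := by
  obtain ⟨g, hg, hdet, rfl⟩ := (mem_veryEvenOrbit_iff hN barred M).mp hM
  have hli : LinearIndependent ℂ fun a => g *ᵥ frame N barred a := by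
    refine linearIndependent_of_dotProduct
      (p := fun a => g *ᵥ dz (!(barred && decide (a.val + 1 = N))) a) fun a b => ?_
    rw [mulVec_dotProduct_mulVec hg, frame, dz_dotProduct]
    by_cases h : a = b
    · subst h
      cases (barred && decide (a.val + 1 = N)) <;> simp
    · simp [h]
  rw [chirality_mulVec_of_annihilated hg hdet (fun a => barred && decide (a.val + 1 = N))
    fun a => hη (mem_range_pairMatrix hN hli a)]
  congr 1
  cases barred
  · simp
  · have : ∀ a : Fin N, (a.val + 1 = N) ↔ a = ⟨N - 1, by omega⟩ := fun a => by
      rw [Fin.ext_iff]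
      simp only
      omega
    simp [this]

/-- A basis of a maximal isotropic subspace is the image of `dz^1, …, dz^N` under an orthogonal
transformation. -/
lemma exists_orthogonal_mulVec_dz {w : Fin N → Idx N → ℂ} (hw : LinearIndependent ℂ w)
    (hiso : ∀ a b, w a ⬝ᵥ w b = 0) :
    ∃ g : Matrix (Idx N) (Idx N) ℂ, g * gᵀ = 1 ∧ ∀ a, g *ᵥ dz false a = w a := by
  obtain ⟨p, hp⟩ := exists_dotProduct_of_linearIndependent hw
  have hp' : ∀ a b, p a ⬝ᵥ w b = if a = b then 1 else 0 := fun a b => by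
    rw [hp, Finsupp.single_apply]
    simp only [eq_comm]
  -- A dual system normalized like `dz̄`, so that `w'·w = 2δ`; the subtracted sum makes it
  -- isotropic.
  let w' : Fin N → Idx N → ℂ := fun b => (2 : ℂ) • p b - ∑ a, (p a ⬝ᵥ p b) • w a
  have hw'w : ∀ a b, w' a ⬝ᵥ w b = if a = b then 2 else 0 := by
    intro a b
    simp [w', sub_dotProduct, smul_dotProduct, sum_dotProduct, hiso, hp']
  have hww' : ∀ a b, w a ⬝ᵥ w' b = if a = b then 2 else 0 := by
    intro a b
    rw [dotProduct_comm, hw'w]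
    simp only [eq_comm]
  have hw'w' : ∀ a b, w' a ⬝ᵥ w' b = 0 := by
    intro a b
    conv_lhs => rw [show w' b = (2 : ℂ) • p b - ∑ c, (p c ⬝ᵥ p b) • w c from rfl]
    simp only [dotProduct_sub, dotProduct_smul, dotProduct_sum, hw'w]
    have : w' a ⬝ᵥ p b = p a ⬝ᵥ p b := by
      simp only [w', sub_dotProduct, smul_dotProduct, sum_dotProduct]
      simp_rw [dotProduct_comm (w _) (p b), hp']
      simp [dotProduct_comm (p b) (p a)]
      ring
    rw [this]
    simp
    ring
  -- The images of `dx` and `dy`, solved from `dx + i dy ↦ w` and `dx - i dy ↦ w'`.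
  let col : Idx N → Idx N → ℂ := Sum.elim (fun a => (2⁻¹ : ℂ) • (w a + w' a))
    fun a => (-(Complex.I * 2⁻¹)) • (w a - w' a)
  let g : Matrix (Idx N) (Idx N) ℂ := of fun i j => col j i
  have hg : gᵀ * g = 1 := by
    ext i j
    have : (gᵀ * g) i j = col i ⬝ᵥ col j := rfl
    rw [this, one_apply]
    rcases i with a | a <;> rcases j with b | b <;>
      simp only [col, Sum.elim_inl, Sum.elim_inr, smul_dotProduct, dotProduct_smul, add_dotProduct,
        sub_dotProduct, dotProduct_add, dotProduct_sub, hiso, hw'w, hww', hw'w', Sum.inl.injEq,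
        Sum.inr.injEq, reduceCtorEq, if_false, smul_eq_mul] <;> split_ifs <;> ring_nf
    simp
  have hcol : ∀ i, g *ᵥ dx i = col i := by
    intro i
    ext j
    simp [dx, g]
  refine ⟨g, mul_eq_one_comm.mp hg, fun a => ?_⟩
  rw [dx_mulVec_eq, hcol, hcol]
  ext i
  simp [col]
  ring_nf
  simp
  ring

/-- The reflection of the last coordinate. -/
def reflection (N : ℕ) (h0 : 0 < N) : Matrix (Idx N) (Idx N) ℂ :=
  diagonal fun i => if i = Sum.inr ⟨N - 1, by omega⟩ then -1 else 1

lemma reflection_mul_transpose (h0 : 0 < N) :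
    reflection N h0 * (reflection N h0)ᵀ = 1 := by
  rw [reflection, diagonal_transpose, diagonal_mul_diagonal, ← diagonal_one]
  congr 1
  funext i
  split_ifs <;> simp

lemma det_reflection (h0 : 0 < N) : (reflection N h0).det = -1 := by
  rw [reflection, det_diagonal]
  simp

lemma reflection_mulVec_frame (h0 : 0 < N) (a : Fin N) :
    reflection N h0 *ᵥ frame N true a = dz false a := by
  have h : ∀ i, reflection N h0 *ᵥ dx i =
      (if i = Sum.inr ⟨N - 1, by omega⟩ then (-1 : ℂ) else 1) • dx i := by
    intro i
    ext j
    simp only [reflection, mulVec_diagonal, dx, Pi.smul_apply, Pi.single_apply, smul_eq_mul]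
    by_cases hji : j = i
    · subst hji; simp
    · simp [hji]
  have ha : (a.val + 1 = N) ↔ a = ⟨N - 1, by omega⟩ := by
    rw [Fin.ext_iff]
    simp only
    omega
  rw [frame, dx_mulVec_eq, h, h, dz]
  by_cases hl : a = ⟨N - 1, by omega⟩
  · simp [ha, ← hl]
  · simp [ha, hl]

lemma mem_veryEvenOrbit_of_rank_eq (h0 : 0 < N) {M : Matrix (Idx N) (Idx N) ℂ} (hM : Mᵀ = -M)
    (hM2 : M * M = 0) (hr : M.rank = N) :
    M ∈ veryEvenOrbit N false ∨ M ∈ veryEvenOrbit N true := by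
  have hN : Even N := hr ▸ even_rank hM
  obtain ⟨m, u, v, hMuv, hli⟩ := exists_eq_sum_wedgeMatrix M hM
  have hm : 2 * m = N := by rw [← hr, hMuv, rank_sum_wedgeMatrix hli]
  obtain rfl : m = N / 2 := by omega
  let σ : Fin N → Fin (N / 2) ⊕ Fin (N / 2) := fun a =>
    if a.val % 2 = 0 then Sum.inl ⟨a.val / 2, by omega⟩ else Sum.inr ⟨a.val / 2, by omega⟩
  have hσ : Function.Injective σ := by
    intro a b h
    simp only [σ] at h
    split_ifs at h <;> simp [Fin.ext_iff] at h ⊢ <;> omega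
  let w : Fin N → Idx N → ℂ := Sum.elim u v ∘ σ
  have hw : LinearIndependent ℂ w := hli.comp σ hσ
  have hMw : M = pairMatrix w := by
    rw [hMuv]
    refine Finset.sum_congr rfl fun m _ => ?_
    have h1 : σ ⟨2 * m.val, by omega⟩ = Sum.inl m := by simp [σ]
    have h2 : σ ⟨2 * m.val + 1, by omega⟩ = Sum.inr m := by
      simp [σ, Nat.add_mod, Fin.ext_iff]
      omega
    simp only [w, Function.comp_apply, h1, h2, Sum.elim_inl, Sum.elim_inr]
  have hiso : ∀ a b, w a ⬝ᵥ w b = 0 := fun a b =>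
    isIsotropic_range hM hM2 _ (hMw ▸ mem_range_pairMatrix hN hw a) _
      (hMw ▸ mem_range_pairMatrix hN hw b)
  obtain ⟨g, hg, hgw⟩ := exists_orthogonal_mulVec_dz hw hiso
  have hdet : g.det = 1 ∨ g.det = -1 := by
    have := congrArg det hg
    rwa [det_mul, det_transpose, det_one, mul_self_eq_one_iff] at this
  rcases hdet with hdet | hdet
  · left
    refine (mem_veryEvenOrbit_iff hN _ _).mpr ⟨g, hg, hdet, ?_⟩
    rw [hMw]
    congr 1
    funext a
    simp [frame, hgw]
  · right
    -- The reflection exchanges the barred frame for the unbarred one and corrects the determinant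
    -- to `1`.
    refine (mem_veryEvenOrbit_iff hN _ _).mpr ⟨g * reflection N h0, ?_, ?_, ?_⟩
    · rw [transpose_mul, Matrix.mul_assoc, ← Matrix.mul_assoc (reflection N h0),
        reflection_mul_transpose, Matrix.one_mul, hg]
    · rw [det_mul, hdet, det_reflection]
      norm_num
    · rw [hMw]
      congr 1
      funext a
      rw [← mulVec_mulVec, reflection_mulVec_frame, hgw]

/-! ### The locus `S = 0` -/

/-- The chiral ring relations on the locus `S = 0`. -/
lemma chiralRing_zero_iff {k : ℕ} {c : Coefficients} {M : Matrix (Idx N) (Idx N) ℂ}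
    {I It : Spinor N} (hM : Mᵀ = -M) : ChiralRing N k c ⟨M, 0, I, It⟩ ↔
      M * M = 0 ∧ chirality N *ᵥ I = I ∧ chirality N *ᵥ It = (-1 : ℂ) ^ N • It ∧
      LinearMap.range M.mulVecLin ≤ spinorAnn I ∧ LinearMap.range M.mulVecLin ≤ spinorAnn It ∧
      (∀ q ≤ k, formPart (2 * q) (bispinor I It) = 0) ∧
      formPart (2 * (k + 1)) (bispinor I It) = c.bilin (k + 1) • twoForm M ^ (k + 1) ∧
      PurityRelation I ∧ PurityRelation It := by
  constructor
  · intro h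
    refine ⟨by simpa using h.meson_sq, h.chirality_I, h.chirality_It,
      (mesonSpinorRelation_zero_iff hM I).mp (by simpa using h.meson_I),
      (mesonSpinorRelation_zero_iff hM It).mp (by simpa using h.meson_It), fun q hq => ?_, ?_,
      h.pure_I, h.pure_It⟩
    · have := h.bilinear q (by omega)
      simpa [zero_pow (show k + 1 - q ≠ 0 by omega)] using this
    · simpa using h.bilinear (k + 1) le_rfl
  · rintro ⟨h1, h2, h3, h4, h5, h6, h7, h8, h9⟩
    refine ⟨hM, h2, h3, by simpa using h1, by simpa using (mesonSpinorRelation_zero_iff hM I).mpr h4,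
      by simpa using (mesonSpinorRelation_zero_iff hM It).mpr h5, fun q hq => ?_, h8, h9⟩
    rcases Nat.lt_or_ge q (k + 1) with hlt | hge
    · simpa [zero_pow (show k + 1 - q ≠ 0 by omega)] using h6 q (by omega)
    · obtain rfl : q = k + 1 := by omega
      simpa using h7

/-- Points at which one of the spinors vanishes. -/
lemma chiralRing_of_bispinor_eq_zero {k : ℕ} {c : Coefficients} {M : Matrix (Idx N) (Idx N) ℂ}
    {I It : Spinor N} (hM : Mᵀ = -M) (hM2 : M * M = 0) (hr : M.rank ≤ 2 * k)
    (hI : chirality N *ᵥ I = I) (hIt : chirality N *ᵥ It = (-1 : ℂ) ^ N • It)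
    (hMI : LinearMap.range M.mulVecLin ≤ spinorAnn I)
    (hMIt : LinearMap.range M.mulVecLin ≤ spinorAnn It)
    (hpI : PurityRelation I) (hpIt : PurityRelation It) (h0 : bispinor I It = 0) :
    ChiralRing N k c ⟨M, 0, I, It⟩ := by
  have hpow := (twoForm_pow_eq_zero_iff hM (k + 1)).mpr (by omega)
  refine (chiralRing_zero_iff hM).mpr ⟨hM2, hI, hIt, hMI, hMIt, fun q _ => ?_, ?_, hpI, hpIt⟩
  · rw [h0, formPart_zero]
  · rw [h0, formPart_zero, hpow, smul_zero]

lemma spinorAnn_zero : spinorAnn (0 : Spinor N) = ⊤ :=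
  eq_top_iff.mpr fun _ _ => mem_spinorAnn.mpr (mulVec_zero _)

/-- A nonzero spinor annihilated by the image of `M` gives a point on each of the two branches with
a single spinor. -/
lemma exists_points_of_spinors {k : ℕ} (c : Coefficients) {M : Matrix (Idx N) (Idx N) ℂ}
    (hM : Mᵀ = -M) (hM2 : M * M = 0) (hr : M.rank ≤ 2 * k)
    (h : ∀ ε : ℂ, (ε = 1 ∨ ε = (-1) ^ N) → ∃ η : Spinor N, η ≠ 0 ∧ chirality N *ᵥ η = ε • η ∧
      LinearMap.range M.mulVecLin ≤ spinorAnn η ∧ PurityRelation η) :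
    (∃ I : Spinor N, I ≠ 0 ∧ ChiralRing N k c ⟨M, 0, I, 0⟩) ∧
      (∃ It : Spinor N, It ≠ 0 ∧ ChiralRing N k c ⟨M, 0, 0, It⟩) := by
  constructor
  · obtain ⟨η, h0, hc, hann, hp⟩ := h 1 (Or.inl rfl)
    exact ⟨η, h0, chiralRing_of_bispinor_eq_zero hM hM2 hr (by rw [hc, one_smul]) (by simp) hann
      (by simp [spinorAnn_zero]) hp purityRelation_zero (bispinor_zero_right η)⟩
  · obtain ⟨η, h0, hc, hann, hp⟩ := h _ (Or.inr rfl)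
    exact ⟨η, h0, chiralRing_of_bispinor_eq_zero hM hM2 hr (by simp) hc (by simp [spinorAnn_zero])
      hann purityRelation_zero hp (bispinor_zero_left η)⟩

lemma exists_pure_spinor_of_mem_orbitPlus (h0 : 0 < N) (hN : Even N)
    {M : Matrix (Idx N) (Idx N) ℂ} (hM : Mᵀ = -M) (hM2 : M * M = 0) (hr : N ≤ M.rank)
    (hplus : M ∈ orbitPlus N) : ∃ η : Spinor N, η ≠ 0 ∧ chirality N *ᵥ η = η ∧
      LinearMap.range M.mulVecLin ≤ spinorAnn η ∧ PurityRelation η := by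
  obtain ⟨η, hη, -, hann⟩ := (isIsotropic_range hM hM2).exists_spinor
  refine ⟨η, hη, ?_, hann, purityRelation_of_le_finrank hη
    (hr.trans (Submodule.finrank_mono hann))⟩
  simpa using chirality_of_mem_veryEvenOrbit h0 hN hplus hann

/-- The isotropic image annihilates some nonzero spinor, which would have to carry both chiralities.
-/
lemma not_mem_orbitPlus_and_orbitMinus (h0 : 0 < N) (hN : Even N)
    {M : Matrix (Idx N) (Idx N) ℂ} (hM : Mᵀ = -M) (hM2 : M * M = 0) :
    ¬ (M ∈ orbitPlus N ∧ M ∈ orbitMinus N) := by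
  rintro ⟨hplus, hminus⟩
  obtain ⟨η, hη, -, hann⟩ := (isIsotropic_range hM hM2).exists_spinor
  have h1 := chirality_of_mem_veryEvenOrbit h0 hN hplus hann
  have h2 := chirality_of_mem_veryEvenOrbit h0 hN hminus hann
  simp only [Bool.false_eq_true, if_false, if_true, one_smul, neg_smul] at h1 h2
  rw [h1] at h2
  exact hη (self_eq_neg.mp h2)

lemma eq_zero_of_mem_orbitMinus (h0 : 0 < N) (hN : Even N) {M : Matrix (Idx N) (Idx N) ℂ}
    (hminus : M ∈ orbitMinus N) {η : Spinor N} (hη : chirality N *ᵥ η = η)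
    (hann : LinearMap.range M.mulVecLin ≤ spinorAnn η) : η = 0 := by
  have h2 := chirality_of_mem_veryEvenOrbit h0 hN hminus hann
  simp only [if_true, neg_smul, one_smul] at h2
  rw [hη] at h2
  exact self_eq_neg.mp h2

/-- The degrees of the bispinor at a point with `S = 0` and two nonzero spinors. -/
lemma spinorType_bounds {k : ℕ} {c : Coefficients} {M : Matrix (Idx N) (Idx N) ℂ}
    {I It : Spinor N} (hM : Mᵀ = -M) (h : ChiralRing N k c ⟨M, 0, I, It⟩) (hI0 : I ≠ 0)
    (hIt0 : It ≠ 0) :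
    M.rank ≤ 2 * (k + 1) ∧
      max M.rank (2 * (k + 1)) ≤ spinorType I It ∧
      spinorType I It ≤ N ∧
      (M.rank = 2 * (k + 1) →
        twoForm M ^ (k + 1) ≠ 0 ∧
        spinorType I It = 2 * (k + 1) ∧
        ∃ β ∈ ⋀[ℂ]^2 (Idx N → ℂ),
          bispinor I It = (c.bilin (k + 1) • twoForm M ^ (k + 1)) * expForm β) ∧
      (M.rank ≤ 2 * k →
        twoForm M ^ (k + 1) = 0 ∧ 2 * (k + 2) ≤ spinorType I It ∧ 2 * k + 4 ≤ N) := by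
  obtain ⟨-, hI, hIt, hMI, hMIt, hlow, htop, hpI, hpIt⟩ := (chiralRing_zero_iff hM).mp h
  have hodd : ∀ q, Odd q → formPart q (bispinor I It) = 0 := fun q => formPart_bispinor_odd hI hIt
  have hlow' : ∀ q < 2 * (k + 1), formPart q (bispinor I It) = 0 := by
    intro q hq
    rcases Nat.even_or_odd' q with ⟨m, rfl | rfl⟩
    · exact hlow m (by omega)
    · exact hodd _ (odd_two_mul_add_one m)
  have hle : LinearMap.range M.mulVecLin ≤ spinorAnn I ⊓ spinorAnn It := le_inf hMI hMIt
  have hann : ∀ q < Module.finrank ℂ ↥(spinorAnn I ⊓ spinorAnn It),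
      formPart q (bispinor I It) = 0 := fun q hq =>
    formPart_eq_zero_of_lt_finrank (fun v hv => ι_mul_bispinor_of_mem hI hIt hv) hq
  have hrank : M.rank ≤ Module.finrank ℂ ↥(spinorAnn I ⊓ spinorAnn It) :=
    Submodule.finrank_mono hle
  obtain ⟨q₀, hq₀N, hq₀⟩ := exists_formPart_bispinor_ne_zero hI hI0 hIt0
  have hne : {q | formPart q (bispinor I It) ≠ 0}.Nonempty := ⟨q₀, hq₀⟩
  have hmem : formPart (spinorType I It) (bispinor I It) ≠ 0 := Nat.sInf_mem hne
  have hge : ∀ {n}, (∀ q < n, formPart q (bispinor I It) = 0) → n ≤ spinorType I It :=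
    fun {n} hn => by
      by_contra! hlt
      exact hmem (hn _ hlt)
  have htypeN : spinorType I It ≤ N := (Nat.sInf_le hq₀).trans hq₀N
  have htype_le : twoForm M ^ (k + 1) ≠ 0 → spinorType I It ≤ 2 * (k + 1) := fun h0 =>
    Nat.sInf_le (show formPart _ _ ≠ 0 by rw [htop]; exact smul_ne_zero (c.bilin_ne _) h0)
  have hannle := hge hann
  have hpow := twoForm_pow_eq_zero_iff hM (k + 1)
  refine ⟨?_, max_le (hrank.trans hannle) (hge hlow'), htypeN, fun hr => ?_, fun hr => ?_⟩
  -- A rank above `2(k+1)` makes `∧^{k+1} M` nonzero, so the type is at most `2(k+1)`, contradicting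
  -- type at least rank.
  · by_contra! hlt
    have := htype_le fun h0 => absurd (hpow.mp h0) (by omega)
    omega
  · have h0 : twoForm M ^ (k + 1) ≠ 0 := fun h0 => absurd (hpow.mp h0) (by omega)
    have ht : spinorType I It = 2 * (k + 1) := le_antisymm (htype_le h0) (hge hlow')
    obtain ⟨β, hβ, hexp⟩ := exists_bispinor_eq_formPart_mul_expForm hI hIt hI0 hIt0 hpI hpIt
    refine ⟨h0, ht, β, hβ, ?_⟩
    -- The dimension is squeezed between the rank and the type, both equal to `2(k+1)`.
    rwa [show Module.finrank ℂ ↥(spinorAnn I ⊓ spinorAnn It) = 2 * (k + 1) by omega,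
      htop] at hexp
  · have h0 := hpow.mpr (by omega)
    -- The part of degree `2k+2` vanishes along with `∧^{k+1} M`, and that of degree `2k+3` by
    -- parity.
    have h4 : 2 * (k + 2) ≤ spinorType I It := hge fun q hq => by
      rcases Nat.even_or_odd' q with ⟨m, rfl | rfl⟩
      · rcases Nat.lt_or_ge m (k + 1) with hm | hm
        · exact hlow m (by omega)
        · obtain rfl : m = k + 1 := by omega
          rw [htop, h0, smul_zero]
      · exact hodd _ (odd_two_mul_add_one m)
    exact ⟨h0, h4, by omega⟩

end HiggsBranch

end

theorem mainTheorem2 (N k : ℕ) (hN : 0 < N) (c : HiggsBranch.Coefficients) :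
    -- the locus `S = 0`
    (∀ p : HiggsBranch.Point N, HiggsBranch.ChiralRing N k c p → p.S = 0 →
      p.M * p.M = 0 ∧
      (∀ q : ℕ, N < 2 * q → HiggsBranch.twoForm p.M ^ q = 0) ∧
      -- both spinors are nonzero
      (p.I ≠ 0 → p.It ≠ 0 →
        p.M.rank ≤ 2 * (k + 1) ∧
        max p.M.rank (2 * (k + 1)) ≤ HiggsBranch.spinorType p.I p.It ∧
        HiggsBranch.spinorType p.I p.It ≤ N ∧
        (p.M.rank = 2 * (k + 1) →
          HiggsBranch.twoForm p.M ^ (k + 1) ≠ 0 ∧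
          HiggsBranch.spinorType p.I p.It = 2 * (k + 1) ∧
          ∃ β ∈ ⋀[ℂ]^2 (HiggsBranch.Idx N → ℂ),
            HiggsBranch.bispinor p.I p.It =
              (c.bilin (k + 1) • HiggsBranch.twoForm p.M ^ (k + 1)) * HiggsBranch.expForm β) ∧
        (p.M.rank ≤ 2 * k →
          HiggsBranch.twoForm p.M ^ (k + 1) = 0 ∧
          2 * (k + 2) ≤ HiggsBranch.spinorType p.I p.It ∧
          2 * k + 4 ≤ N)) ∧
      -- one of the spinors vanishes
      (p.I = 0 ∨ p.It = 0 → HiggsBranch.twoForm p.M ^ (k + 1) = 0 ∧ p.M.rank ≤ 2 * k) ∧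
      (Even N → p.M ∈ HiggsBranch.orbitMinus N → p.I = 0 ∧ p.It = 0)) ∧
    -- the branching: which spinors the mesons allow
    (∀ M : Matrix (HiggsBranch.Idx N) (HiggsBranch.Idx N) ℂ,
      M.transpose = -M → M * M = 0 → M.rank ≤ 2 * k →
        HiggsBranch.ChiralRing N k c ⟨M, 0, 0, 0⟩ ∧
        (M.rank < N ∨ (Even N ∧ M ∈ HiggsBranch.orbitPlus N) →
          (∃ I : HiggsBranch.Spinor N, I ≠ 0 ∧ HiggsBranch.ChiralRing N k c ⟨M, 0, I, 0⟩) ∧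
          (∃ It : HiggsBranch.Spinor N, It ≠ 0 ∧ HiggsBranch.ChiralRing N k c ⟨M, 0, 0, It⟩)) ∧
        (M.rank = N → Even N ∧
          Xor (M ∈ HiggsBranch.orbitPlus N) (M ∈ HiggsBranch.orbitMinus N))) := by

  open HiggsBranch in
  refine ⟨?_, ?_⟩
  · rintro ⟨M, S, I, It⟩ hp (rfl : S = 0)
    have hM := hp.antisymm
    obtain ⟨hM2, hI, hIt, hMI, hMIt, -, htop, -, -⟩ := (chiralRing_zero_iff hM).mp hp
    have hr := rank_le_of_mul_self_eq_zero hM hM2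
    refine ⟨hM2, fun q hq => (twoForm_pow_eq_zero_iff hM q).mpr (by omega),
      spinorType_bounds hM hp, fun h => ?_, fun hN' hminus => ?_⟩
    -- With one spinor zero, `Φ` vanishes and the last bilinear relation forces `∧^{k+1} M = 0`.
    · have hΦ : bispinor I It = 0 := by
        rcases h with rfl | rfl
        exacts [bispinor_zero_left It, bispinor_zero_right I]
      rw [hΦ, formPart_zero] at htop
      have h0 := (smul_eq_zero.mp htop.symm).resolve_left (c.bilin_ne _)
      exact ⟨h0, (rank_lt_iff hM k).mp ((twoForm_pow_eq_zero_iff hM _).mp h0)⟩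
    -- For even `N` both spinors have chirality `+1`, whereas the minus orbit permits only `-1`.
    · rw [hN'.neg_one_pow, one_smul] at hIt
      exact ⟨eq_zero_of_mem_orbitMinus hN hN' hminus hI hMI,
        eq_zero_of_mem_orbitMinus hN hN' hminus hIt hMIt⟩
  · intro M hM hM2 hr
    refine ⟨chiralRing_of_bispinor_eq_zero hM hM2 hr (by simp) (by simp) (by simp [spinorAnn_zero])
      (by simp [spinorAnn_zero]) purityRelation_zero purityRelation_zero (bispinor_zero_left 0),
      fun h => exists_points_of_spinors c hM hM2 hr fun ε hε => ?_, fun hrN => ?_⟩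
    · rcases Nat.lt_or_ge M.rank N with hlt | hge
      · refine (isIsotropic_range hM hM2).exists_pure_spinor hlt ?_
        rcases hε with rfl | rfl
        exacts [Or.inl rfl, neg_one_pow_eq_or ℂ N]
      · obtain ⟨hN', hplus⟩ := h.resolve_left (by omega)
        rw [hN'.neg_one_pow, or_self] at hε
        subst hε
        simpa only [one_smul] using
          exists_pure_spinor_of_mem_orbitPlus hN hN' hM hM2 hge hplus
    · have hN' : Even N := hrN ▸ even_rank hM
      have hnot := not_mem_orbitPlus_and_orbitMinus hN hN' hM hM2
      refine ⟨hN', ?_⟩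
      rcases mem_veryEvenOrbit_of_rank_eq hN hM hM2 hrN with h | h
      · exact Or.inl ⟨h, fun h' => hnot ⟨h, h'⟩⟩
      · exact Or.inr ⟨h, fun h' => hnot ⟨h', h⟩⟩
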